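/- Let $X$ be a non-empty simplicial graph. Subgraphs are induced and are identified with their vertex sets; $lk(Y)$ is the set of vertices adjacent to every vertex of $Y$. A *graph factor system* $\mathfrak F$ on $X$ of complexity $n$ is a collection of non-empty induced subgraphs (*domains*) such that $X\in\mathfrak F$; $lk(v)\in\mathfrak F$ for every vertex $v$ with $lk(v)\neq\emptyset$; $F_1\cap F_2\in\mathfrak F$ whenever $F_1,F_2\in\mathfrak F$ and $F_1\cap F_2\ne\emptyset$; and every chain $F_1\subsetneq\dots\subsetneq F_k$ in $\mathfrak F$ has $k<n$. For an induced subgraph $F$, an *$F$-graph* is a graph whose vertices are the maximal cliques of $F$. Write $F^\perp=lk(F)$. Given an $X$-graph $W$, let $B=\{b_F : F\in\mathfrak F\setminus\{X\}\}$ be a set of new vertices. The *augmented graph* $CX$ has vertex set $V(X)\cup B$; two distinct vertices $v,w$ of $X$ are adjacent if they are adjacent in $X$ or lie in two $W$-adjacent maximal cliques respectively; $v\in V(X)$ and $b_F$ are adjacent if $v\in F$; there are no other edges. For $F\in\mathfrak F$, $CF$ is the subgraph of $CX$ induced on $V(F)\cup\{b_H : H\in\mathfrak F,\ H\subsetneq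 F\}$, and the *complement graph* $Y_F$ is the subgraph of $CX$ induced on $(V(X)\cup B)\setminus PF$, where $$PF=F^\perp\cup\{b_H\in B : H\subseteq F^\perp\}\cup\{b_H\in B : F\subseteq H\}.$$ For an $F$-graph $W^F$ and a domain $F'\subseteq F$, let $C_FF'$ denote the graph $CF'$ formed with $(F,W^F,\{H\in\mathfrak F: H\subseteq F\})$ in place of $(X,W,\mathfrak F)$. The triple $(X,W,\mathfrak F)$ is a *combinatorial HHS with factor system* (CHHF) with constants $n\in\mathbb N$ and $\delta>0$ if $\mathfrak F$ is a graph factor system of complexity $n$ and 1. (hyperbolicity) for every $F\in\mathfrak F$ the graph $CF$ is $\delta$-hyperbolic, and the inclusion $CF\hookrightarrow Y_F$ is a $(\delta,\delta)$-quasi-isometric embedding; 2. (hierarchy) there are $F$-graphs $W^F$, $F\in\mathfrak F$, such that for all domains $F'\subseteq F$ we have $C_FF'=CF'$, and for every (possibly empty) maximal clique $x$ of $F'^\perp\cap F$ there is a graph morphism $W^{F'}\to W^F$ sending each maximal clique $w$ of $F'$ to a maximal clique of $F$ that contains $x\ast w$. Here a graph is called $\delta$-hyperbolic if it is connected and each side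 of each geodesic triangle with vertices at vertices of the graph lies, at the level of vertices, in the $\delta$-neighbourhood of the union of the other two sides. **Lemma 3.10.** For every $n\in\mathbb N$ and $\delta>0$ there is $\delta'=\delta'(n,\delta)>0$ such that for every CHHF $(X,W,\mathfrak F)$ with constants $n$ and $\delta$ and for every domain $F\in\mathfrak F$, the complement graph $Y_F$ is $\delta'$-hyperbolic. -/

import Mathlib

universe u

/-- A graph is `δ`-hyperbolic if it is connected and its geodesic triangles are `δ`-slim. -/
def IsHyperbolicGraph {α : Type*} (δ : ℝ) (G : SimpleGraph α) : Prop :=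
  G.Connected ∧
    ∀ (x y z : α) (p : G.Walk x y) (q : G.Walk y z) (r : G.Walk x z),
      p.length = G.dist x y → q.length = G.dist y z → r.length = G.dist x z →
        ∀ a ∈ p.support, ∃ b, (b ∈ q.support ∨ b ∈ r.support) ∧ (G.dist a b : ℝ) ≤ δ

/-- A `(K, C)`-quasi-isometric embedding of a connected graph `G` into a graph `H`
(on vertices, for the path metrics). Reachability is required because `SimpleGraph.dist` has the
value `0` on pairs of vertices in distinct components. -/
def IsQIEmbedding {α β : Type*} (K C : ℝ) (G : SimpleGraph α) (H : SimpleGraph β)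
    (f : α → β) : Prop :=
  ∀ x y : α, H.Reachable (f x) (f y) ∧
    (G.dist x y : ℝ) / K - C ≤ (H.dist (f x) (f y) : ℝ) ∧
    (H.dist (f x) (f y) : ℝ) ≤ K * (G.dist x y : ℝ) + C

namespace CHHF

variable {V : Type u}

/-- The link of a set of vertices: the vertices adjacent to all of its members. Induced subgraphs
of `X` are represented by their vertex sets throughout. -/
def link (X : SimpleGraph V) (S : Set V) : Set V := {v | ∀ w ∈ S, X.Adj v w}

/-- The maximal cliques of the subgraph of `X` induced by `S`. -/
abbrev MaxClique (X : SimpleGraph V) (S : Set V) : Type u :=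
  {c : Set V // Maximal (fun s : Set V => s ⊆ S ∧ X.IsClique s) c}

/-- `𝔉` is a graph factor system on `X` of complexity (at most) `n`; domains are non-empty. -/
structure IsGraphFactorSystem (X : SimpleGraph V) (𝔉 : Set (Set V)) (n : ℕ) : Prop where
  nonempty : ∀ F ∈ 𝔉, F.Nonempty
  univ_mem : Set.univ ∈ 𝔉
  link_mem : ∀ v : V, (link X {v}).Nonempty → link X {v} ∈ 𝔉
  inter_mem : ∀ F₁ ∈ 𝔉, ∀ F₂ ∈ 𝔉, (F₁ ∩ F₂).Nonempty → F₁ ∩ F₂ ∈ 𝔉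
  chain_lt : ∀ (k : ℕ) (F : Fin k → Set V), StrictMono F → (∀ i, F i ∈ 𝔉) → k < n

/-- Ambient type for the vertices of augmented graphs: `Sum.inl v` is the vertex `v` of the
graph and `Sum.inr F` is the projection vertex `b_F`. -/
abbrev AugVertex (V : Type u) : Type u := V ⊕ Set V

/-- The three kinds of edges of the augmented graph: edges of `X`, additional edges between
vertices in `W`-adjacent maximal cliques, edges from `b_F` to the vertices of `F`. -/
def augRel (X : SimpleGraph V) {S : Set V} (W : SimpleGraph (MaxClique X S)) :
    AugVertex V → AugVertex V → Prop
  | Sum.inl v, Sum.inl w => X.Adj v w ∨ ∃ c d : MaxClique X S, W.Adj c d ∧ v ∈ c.1 ∧ w ∈ d.1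
  | Sum.inl v, Sum.inr F => v ∈ F
  | Sum.inr _, _ => False

/-- Adjacency in the augmented graph of the subgraph of `X` induced by `S`, where `W` is an
`S`-graph, on the ambient type; it is only used after restriction to a set of vertices of this
augmented graph. Symmetrized and without loops. -/
def augAdj (X : SimpleGraph V) {S : Set V} (W : SimpleGraph (MaxClique X S)) :
    SimpleGraph (AugVertex V) :=
  SimpleGraph.fromRel (augRel X W)

/-- The vertex set `V(F) ∪ B_F`, with `B_F` the projection vertices of domains properly
contained in `F`. -/
def augVerts (𝔉 : Set (Set V)) (F : Set V) : Set (AugVertex V) :=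
  Sum.inl '' F ∪ Sum.inr '' {H | H ∈ 𝔉 ∧ H ⊂ F}

/-- For a domain `F ⊆ S` and an `S`-graph `W`: the augmented graph `C_S F`, that is, the subgraph
induced on `V(F) ∪ B_F` in the augmented graph of `S`. For `S = univ` it is `CF`, and for
`S = F = univ` it is `CX`. -/
def augGraph (X : SimpleGraph V) {S : Set V} (W : SimpleGraph (MaxClique X S))
    (𝔉 : Set (Set V)) (F : Set V) : SimpleGraph (augVerts 𝔉 F) :=
  (augAdj X W).induce (augVerts 𝔉 F)

/-- The projection part `PF`: the vertices of `F^⊥ = lk(F)`, the projection vertices of the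
domains contained in `F^⊥` (including `F^⊥` itself when it is a domain), and the projection
vertices of the proper domains containing `F`. -/
def projPart (X : SimpleGraph V) (𝔉 : Set (Set V)) (F : Set V) : Set (AugVertex V) :=
  Sum.inl '' link X F ∪ Sum.inr '' {H | H ∈ 𝔉 ∧ H ⊂ Set.univ ∧ (H ⊆ link X F ∨ F ⊆ H)}

/-- The vertex set `(V(X) ∪ B) - PF` of the complement graph. -/
def complVerts (X : SimpleGraph V) (𝔉 : Set (Set V)) (F : Set V) : Set (AugVertex V) :=
  augVerts 𝔉 Set.univ \ projPart X 𝔉 F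

/-- The complement graph `Y_F`: the subgraph of `CX` induced on `(V(X) ∪ B) - PF`. -/
def complGraph (X : SimpleGraph V) (W : SimpleGraph (MaxClique X Set.univ))
    (𝔉 : Set (Set V)) (F : Set V) : SimpleGraph (complVerts X 𝔉 F) :=
  (augAdj X W).induce (complVerts X 𝔉 F)

/-- The vertices of `CF` always lie in `Y_F`. -/
theorem augVerts_subset_complVerts {X : SimpleGraph V} {𝔉 : Set (Set V)} {n : ℕ}
    (h : IsGraphFactorSystem X 𝔉 n) (F : Set V) :
    augVerts 𝔉 F ⊆ complVerts X 𝔉 F := by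
  rintro _ (⟨v, hv, rfl⟩ | ⟨H, ⟨hH, hHF⟩, rfl⟩)
  · refine ⟨Or.inl ⟨v, Set.mem_univ v, rfl⟩, ?_⟩
    rintro (⟨w, hw, hwv⟩ | ⟨K, _, hK⟩)
    · obtain rfl := Sum.inl.inj hwv
      exact (hw w hv).ne rfl
    · cases hK
  · refine ⟨Or.inr ⟨H, ⟨hH, hHF.trans_subset (Set.subset_univ F)⟩, rfl⟩, ?_⟩
    rintro (⟨w, _, hw⟩ | ⟨K, ⟨_, _, hK⟩, hKH⟩)
    · cases hw
    · obtain rfl := Sum.inr.inj hKH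
      rcases hK with hK | hK
      · obtain ⟨v, hv⟩ := h.nonempty K hH
        exact (hK hv v (hHF.1 hv)).ne rfl
      · exact hHF.2 hK

/-- The `δ`-hyperbolicity condition: every `CF` is `δ`-hyperbolic, and the inclusion of `CF`
in `Y_F` is a `(δ, δ)`-quasi-isometric embedding. -/
def HyperbolicityCondition (X : SimpleGraph V) (W : SimpleGraph (MaxClique X Set.univ))
    (𝔉 : Set (Set V)) (δ : ℝ) : Prop :=
  ∀ F ∈ 𝔉, IsHyperbolicGraph δ (augGraph X W 𝔉 F) ∧
    ∃ h : augVerts 𝔉 F ⊆ complVerts X 𝔉 F,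
      IsQIEmbedding δ δ (augGraph X W 𝔉 F) (complGraph X W 𝔉 F) (Set.inclusion h)

/-- The hierarchy condition: there are `F`-graphs `W^F` (`F ∈ 𝔉`) such that `C_F F' = CF'` for
all domains `F' ⊆ F`, and every maximal clique `x` of `F'^⊥ ∩ F` (possibly empty) admits a graph
morphism `W^{F'} → W^F` taking `w` to a maximal clique of `F` that contains the join `x ∗ w`. -/
def HierarchyCondition (X : SimpleGraph V) (W : SimpleGraph (MaxClique X Set.univ))
    (𝔉 : Set (Set V)) : Prop :=
  ∃ WF : ∀ F : Set V, SimpleGraph (MaxClique X F),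
    ∀ F ∈ 𝔉, ∀ F' ∈ 𝔉, F' ⊆ F →
      augGraph X (WF F) 𝔉 F' = augGraph X W 𝔉 F' ∧
      ∀ x : MaxClique X (link X F' ∩ F),
        ∃ φ : WF F' →g WF F, ∀ w : MaxClique X F', x.1 ∪ w.1 ⊆ (φ w).1

/-- `(X, W, 𝔉)` is a combinatorial HHS with factor system, with complexity `n` and
hyperbolicity constant `δ`. -/
structure IsCHHF (X : SimpleGraph V) (W : SimpleGraph (MaxClique X Set.univ))
    (𝔉 : Set (Set V)) (n : ℕ) (δ : ℝ) : Prop where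
  factorSystem : IsGraphFactorSystem X 𝔉 n
  hyperbolicity : HyperbolicityCondition X W 𝔉 δ
  hierarchy : HierarchyCondition X W 𝔉

end CHHF

/-! The graph `Y_F` is obtained from `CX` by two kinds of deletion, each of which preserves
hyperbolicity with control on the constants.

The first deletes `F^⊥` and the `b_K` with `K ⊆ F^⊥` (`perpPart`). Inside any `CL` with `F ⊊ L`,
this set lies within bounded distance of `b_F`. Each neighbour of it outside the set reaches `b_F`
by a path of length at most 5 avoiding the set (`isExcisable_perpPart`). Geodesics can therefore be
rerouted through `b_F`, so that `CL` minus `perpPart` is hyperbolic and undistorted in `CL`.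

The second deletes the `b_L` with `F ⊆ L ⊊ X`, one coheight at a time and larger domains earlier.
Such a `b_L` is a cone point over `CL` minus `perpPart`. When its turn comes, what remains of the
graph without `b_L` lies in `Y_L`, where `CL` is quasi-isometrically embedded. Removing cone points
over hyperbolic bases embedded in this way keeps a graph hyperbolic
(`exists_hyperbolic_of_isConeFamily`): a geodesic is repaired by replacing each passage through a
cone point with a geodesic of the base. Complexity bounds the number of rounds by `n + 1`.

Both deletions are justified by guessing geodesics (`exists_hyperbolic_of_isSlimFamily`): connected
sets joining pairs of points and forming slim triangles are close to the geodesics. -/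

namespace SimpleGraph

/-! ### Guessing geodesics. -/

variable {β : Type*} {H : SimpleGraph β}

theorem Walk.dist_getVert_le {x y : β} (p : H.Walk x y) {i j : ℕ} (hij : i ≤ j) :
    H.dist (p.getVert i) (p.getVert j) ≤ j - i := by
  have h := H.dist_le ((p.drop i).take (j - i))
  rw [Walk.take_length, Walk.drop_getVert, Nat.add_sub_cancel' hij] at h
  omega

theorem Walk.dist_getVert_of_geodesic (hH : H.Connected) {x y : β} {p : H.Walk x y}
    (hp : p.length = H.dist x y) {i j : ℕ} (hij : i ≤ j) (hj : j ≤ p.length) :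
    H.dist (p.getVert i) (p.getVert j) = j - i := by
  have h₁ := p.dist_getVert_le hij
  have h₂ := p.dist_getVert_le (Nat.zero_le i)
  have h₃ := p.dist_getVert_le hj
  rw [Walk.getVert_zero] at h₂
  rw [Walk.getVert_length] at h₃
  have h₄ := hH.dist_triangle (u := x) (v := p.getVert i) (w := y)
  have h₅ := hH.dist_triangle (u := p.getVert i) (v := p.getVert j) (w := y)
  omega

theorem Walk.take_geodesic (hH : H.Connected) {x y : β} {p : H.Walk x y}
    (hp : p.length = H.dist x y) {i : ℕ} (hi : i ≤ p.length) :
    (p.take i).length = H.dist x (p.getVert i) := by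
  have := Walk.dist_getVert_of_geodesic hH hp (Nat.zero_le i) hi
  rw [Walk.getVert_zero] at this
  rw [Walk.take_length, this]
  omega

theorem Walk.drop_geodesic (hH : H.Connected) {x y : β} {p : H.Walk x y}
    (hp : p.length = H.dist x y) {i : ℕ} (hi : i ≤ p.length) :
    (p.drop i).length = H.dist (p.getVert i) y := by
  have := Walk.dist_getVert_of_geodesic hH hp hi le_rfl
  rw [Walk.getVert_length] at this
  rw [Walk.drop_length, this]

/-- A family of sets `L x y`, each containing a walk from `x` to `y`, that is `h`-small for nearby
points and has `h`-slim triangles. -/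
structure IsSlimFamily (H : SimpleGraph β) (L : β → β → Set β) (h : ℕ) : Prop where
  walk : ∀ x y, ∃ p : H.Walk x y, ∀ v ∈ p.support, v ∈ L x y
  small : ∀ x y, H.dist x y ≤ 1 → ∀ v ∈ L x y, H.dist v x ≤ h
  slim : ∀ x y z, ∀ v ∈ L x y, ∃ w, (w ∈ L x z ∨ w ∈ L z y) ∧ H.dist v w ≤ h

namespace IsSlimFamily

variable {L : β → β → Set β} {h : ℕ}

theorem connected [Nonempty β] (hL : IsSlimFamily H L h) : H.Connected :=
  ⟨fun x y => ⟨(hL.walk x y).choose⟩⟩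

/-- Halving the walk and applying slimness costs `h` per halving, so the distance to an arbitrary
walk grows only logarithmically with its length. -/
theorem near_walk (hL : IsSlimFamily H L h) (hH : H.Connected) (m : ℕ) :
    ∀ {x y : β} (p : H.Walk x y), p.length ≤ 2 ^ m → ∀ v ∈ L x y,
      ∃ i, H.dist v (p.getVert i) ≤ h * m + h := by
  induction m with
  | zero =>
    intro x y p hp v hv
    refine ⟨0, ?_⟩
    have := hL.small x y ((H.dist_le p).trans (by simpa using hp)) v hv
    simpa using this
  | succ m ih =>
    intro x y p hp v hv
    rw [pow_succ] at hp
    obtain ⟨w, hw, hvw⟩ := hL.slim x y (p.getVert (2 ^ m)) v hv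
    rcases hw with hw | hw
    · obtain ⟨i, hi⟩ := ih (p.take (2 ^ m)) (by rw [Walk.take_length]; omega) w hw
      refine ⟨2 ^ m ⊓ i, ?_⟩
      rw [Walk.take_getVert] at hi
      have := hH.dist_triangle (u := v) (v := w) (w := p.getVert (2 ^ m ⊓ i))
      rw [Nat.mul_succ]; omega
    · obtain ⟨i, hi⟩ := ih (p.drop (2 ^ m)) (by rw [Walk.drop_length]; omega) w hw
      refine ⟨2 ^ m + i, ?_⟩
      rw [Walk.drop_getVert] at hi
      have := hH.dist_triangle (u := v) (v := w) (w := p.getVert (2 ^ m + i))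
      rw [Nat.mul_succ]; omega

theorem exists_log_bound (h : ℕ) :
    ∃ R, 3 * h + 1 ≤ R ∧ ∀ r, R < r → ∃ m, 6 * r ≤ 2 ^ m ∧ h * m + 3 * h < r := by
  refine ⟨2 ^ (24 * h + 100), ?_, fun r hr => ?_⟩
  · have := Nat.lt_two_pow_self (n := 24 * h + 100)
    omega
  · obtain ⟨s, hs₁, hs₂⟩ : ∃ s, 2 ^ s ≤ r ∧ r < 2 ^ (s + 1) :=
      ⟨Nat.log 2 r, Nat.pow_log_le_self 2 ((Nat.zero_le _).trans_lt hr).ne',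
          Nat.lt_pow_succ_log_self (by norm_num) r⟩
    have hs : 24 * h + 100 ≤ s := by
      by_contra hcon
      have : 2 ^ (s + 1) ≤ 2 ^ (24 * h + 100) := Nat.pow_le_pow_right (by norm_num) (by omega)
      omega
    refine ⟨s + 4, ?_, lt_of_lt_of_le ?_ hs₁⟩
    · rw [pow_add] at hs₂ ⊢
      norm_num at hs₂ ⊢
      omega
    -- With `s` about `2 * a`, the bound `a < 2 ^ a` squares to a quadratic lower bound for `2 ^ s`,
    -- which beats the linear term.
    · obtain ⟨a, rfl | rfl⟩ : ∃ a, s = 2 * a ∨ s = 2 * a + 1 := ⟨s / 2, by omega⟩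
      · have ha := Nat.lt_two_pow_self (n := a)
        rw [two_mul, pow_add]
        nlinarith [Nat.mul_le_mul ha.le ha.le]
      · have ha := Nat.lt_two_pow_self (n := a)
        rw [two_mul, pow_succ, pow_add]
        nlinarith [Nat.mul_le_mul ha.le ha.le]

/-- Suppose the nearest point `k c` of the geodesic is at distance `r > R` from `v`, and cut `k` at
`c ± 3r`. Slimness puts `v` within `2h` of the set of one of the three pieces. The outer pieces are
shorter, and induction would give a point of `k` too close to `v`. The middle piece has length at
most `6r`, and the logarithmic bound gives a point nearer than `r`. -/
theorem near_geodesic (hL : IsSlimFamily H L h) (hH : H.Connected) {R : ℕ} (hR : 3 * h + 1 ≤ R)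
    (hlog : ∀ r, R < r → ∃ m, 6 * r ≤ 2 ^ m ∧ h * m + 3 * h < r) (l : ℕ) :
    ∀ {x y : β} (k : H.Walk x y), k.length = H.dist x y → k.length = l → ∀ v ∈ L x y,
      ∃ i ≤ k.length, H.dist v (k.getVert i) ≤ R := by
  induction l using Nat.strong_induction_on with
  | _ l ih =>
  intro x y k hk hl v hv
  by_contra! hcon
  obtain ⟨c, hc, hmin⟩ := Finset.exists_min_image (Finset.range (k.length + 1))
    (fun i => H.dist v (k.getVert i)) ⟨0, by simp⟩
  have hc' : c ≤ k.length := by simpa [Nat.lt_succ_iff] using hc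
  set r := H.dist v (k.getVert c) with hr
  have hmin' : ∀ i, i ≤ k.length → r ≤ H.dist v (k.getVert i) := fun i hi =>
    hmin i (by simpa [Nat.lt_succ_iff] using hi)
  have hrR : R < r := hcon c hc'
  have hpos : 0 < k.length := by
    by_contra h0
    have := hL.small x y (by omega) v hv
    have h0' := hcon 0 (Nat.zero_le _)
    rw [Walk.getVert_zero] at h0'
    omega
  -- This excludes an outer piece `q`. Its points are at least `3r` from `k c`, hence `2r` from `v`,
  -- unless the cut was truncated at an endpoint of `k` and `q` is trivial.
  have hshort : ∀ {a b : β} (q : H.Walk a b), q.length = H.dist a b → q.length < k.length →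
      (∀ j ≤ q.length, ∃ i ≤ k.length, k.getVert i = q.getVert j ∧
        (3 * r ≤ c - i ∨ 3 * r ≤ i - c ∨ q.length = 0)) →
      ∀ u ∈ L a b, H.dist v u ≤ 2 * h → False := by
    intro a b q hq hqk hqi u hu hvu
    obtain ⟨j, hj, hju⟩ := ih q.length (by omega) q hq rfl u hu
    obtain ⟨i, hi, hij, hfar⟩ := hqi j hj
    rw [← hij] at hju
    have h₁ := hH.dist_triangle (u := v) (v := u) (w := k.getVert i)
    rcases hfar with hfar | hfar | hfar
    · have h₂ := Walk.dist_getVert_of_geodesic hH hk (show i ≤ c by omega) hc'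
      have h₃ := hH.dist_triangle (u := k.getVert i) (v := v) (w := k.getVert c)
      rw [H.dist_comm (u := k.getVert i) (v := v)] at h₃
      omega
    · have h₂ := Walk.dist_getVert_of_geodesic hH hk (show c ≤ i by omega) hi
      have h₃ := hH.dist_triangle (u := k.getVert c) (v := v) (w := k.getVert i)
      rw [H.dist_comm (u := k.getVert c) (v := v)] at h₃
      omega
    · obtain rfl : j = 0 := by omega
      have h₂ := hL.small a b (by omega) u hu
      rw [hij, Walk.getVert_zero] at h₁
      have h₃ := hmin' i hi
      rw [hij, Walk.getVert_zero] at h₃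
      omega
  obtain ⟨u, hu | hu, hvu⟩ := hL.slim x y (k.getVert (c - 3 * r)) v hv
  · refine hshort (k.take (c - 3 * r)) (Walk.take_geodesic hH hk (by omega))
      (by rw [Walk.take_length]; omega) (fun j hj => ⟨j, ?_, ?_, ?_⟩) u hu (by omega)
    · rw [Walk.take_length] at hj; omega
    · rw [Walk.take_length] at hj
      rw [Walk.take_getVert, min_eq_right (by omega)]
    · rw [Walk.take_length] at hj ⊢
      omega
  obtain ⟨w, hw | hw, huw⟩ := hL.slim (k.getVert (c - 3 * r)) y (k.getVert (c + 3 * r)) u hu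
  · obtain ⟨m, hm, hmr⟩ := hlog r hrR
    have hdrop := Walk.drop_getVert k (c - 3 * r) (c + 3 * r - (c - 3 * r))
    have hle : c - 3 * r ≤ c + 3 * r := by omega
    rw [Nat.add_sub_cancel' hle] at hdrop
    obtain ⟨i, hi⟩ := hL.near_walk hH m
      (((k.drop (c - 3 * r)).take (c + 3 * r - (c - 3 * r))).copy rfl hdrop)
      (by rw [Walk.length_copy, Walk.take_length]; omega) w hw
    rw [Walk.getVert_copy, Walk.take_getVert, Walk.drop_getVert] at hi
    set s := c - 3 * r + (c + 3 * r - (c - 3 * r)) ⊓ i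
    have h₁ := hH.dist_triangle (u := v) (v := u) (w := k.getVert s)
    have h₂ := hH.dist_triangle (u := u) (v := w) (w := k.getVert s)
    -- `getVert` is constant past the end of the walk, so an index beyond `k.length` stands for `y`.
    rcases le_total s k.length with hs | hs
    · have := hmin' s hs
      omega
    · have := hmin' _ le_rfl
      rw [Walk.getVert_length] at this
      rw [Walk.getVert_of_length_le _ hs] at h₁ h₂ hi
      omega
  · have htri := hH.dist_triangle (u := v) (v := u) (w := w)
    rcases le_total (c + 3 * r) k.length with hs | hs
    · refine hshort (k.drop (c + 3 * r)) (Walk.drop_geodesic hH hk hs)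
        (by rw [Walk.drop_length]; omega) (fun j hj => ⟨c + 3 * r + j, ?_, ?_, ?_⟩) w hw (by omega)
      · rw [Walk.drop_length] at hj; omega
      · rw [Walk.drop_getVert]
      · omega
    · have h₁ := hL.small _ _ (by rw [Walk.getVert_of_length_le _ hs]; simp) w hw
      have h₂ := hmin' _ le_rfl
      rw [Walk.getVert_length] at h₂
      rw [Walk.getVert_of_length_le _ hs] at h₁
      have h₃ := hH.dist_triangle (u := v) (v := w) (w := y)
      omega

/-- Follow a walk in `L x y` until it stops being `R`-close to the part of `k` up to `i`. The edge
where this happens has ends close to `k j` and `k j'` with `j ≤ i < j'`, so `j' - j ≤ 2R + 1`. -/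
theorem geodesic_near (hL : IsSlimFamily H L h) (hH : H.Connected) {R : ℕ}
    (hR : ∀ {x y : β} (k : H.Walk x y), k.length = H.dist x y → ∀ v ∈ L x y,
      ∃ i ≤ k.length, H.dist v (k.getVert i) ≤ R)
    {x y : β} (k : H.Walk x y) (hk : k.length = H.dist x y) {i : ℕ} (hi : i ≤ k.length) :
    ∃ v ∈ L x y, H.dist (k.getVert i) v ≤ 3 * R + 1 := by
  obtain ⟨p, hp⟩ := hL.walk x y
  let Q : Set β := {u | ∃ j ≤ i, H.dist u (k.getVert j) ≤ R}
  have hxQ : x ∈ Q := ⟨0, Nat.zero_le _, by simp⟩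
  have hdist : ∀ {u : β} {j : ℕ}, j ≤ i → H.dist u (k.getVert j) ≤ R →
      H.dist (k.getVert i) u ≤ (i - j) + R := by
    intro u j hj hu
    have h₁ := k.dist_getVert_le hj
    have h₂ := hH.dist_triangle (u := k.getVert i) (v := k.getVert j) (w := u)
    rw [H.dist_comm (u := k.getVert i) (v := k.getVert j), H.dist_comm (u := k.getVert j)
        (v := u)] at h₂
    omega
  by_cases hyQ : y ∈ Q
  · obtain ⟨j, hj, hju⟩ := hyQ
    refine ⟨y, hp y p.end_mem_support, (hdist hj hju).trans ?_⟩
    have := Walk.dist_getVert_of_geodesic hH hk (hj.trans hi) le_rfl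
    rw [Walk.getVert_length, H.dist_comm] at this
    omega
  · obtain ⟨d, hd, ⟨j, hj, hju⟩, hsnd⟩ := p.exists_boundary_dart Q hxQ hyQ
    refine ⟨d.fst, hp _ (p.dart_fst_mem_support_of_mem_darts hd), (hdist hj hju).trans ?_⟩
    obtain ⟨j', hj', hju'⟩ := hR k hk d.snd (hp _ (p.dart_snd_mem_support_of_mem_darts hd))
    have hlt : i < j' := by
      by_contra hle
      exact hsnd ⟨j', by omega, hju'⟩
    have h₁ := Walk.dist_getVert_of_geodesic hH hk (hj.trans hlt.le) hj'
    have h₂ := hH.dist_triangle (u := k.getVert j) (v := d.fst) (w := k.getVert j')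
    have h₃ := hH.dist_triangle (u := d.fst) (v := d.snd) (w := k.getVert j')
    have h₄ : H.dist d.fst d.snd = 1 := dist_eq_one_iff_adj.2 d.adj
    rw [H.dist_comm (u := k.getVert j) (v := d.fst)] at h₂
    omega

end IsSlimFamily

/-- Guessing geodesics: a graph with a slim family of connected sets is hyperbolic. -/
theorem exists_hyperbolic_of_isSlimFamily (h : ℕ) :
    ∃ N : ℕ, ∀ (β : Type*) [Nonempty β] (H : SimpleGraph β) (L : β → β → Set β),
      IsSlimFamily H L h → IsHyperbolicGraph N H := by
  obtain ⟨R, hR, hlog⟩ := IsSlimFamily.exists_log_bound h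
  refine ⟨4 * R + 1 + h, fun β _ H L hL => ⟨hL.connected, ?_⟩⟩
  have hH := hL.connected
  have hnear : ∀ {x y : β} (k : H.Walk x y), k.length = H.dist x y → ∀ v ∈ L x y,
      ∃ i ≤ k.length, H.dist v (k.getVert i) ≤ R :=
    fun k hk => hL.near_geodesic hH hR hlog _ k hk rfl
  intro x y z p q r hp hq hr a ha
  obtain ⟨i, rfl, hi⟩ := Walk.mem_support_iff_exists_getVert.1 ha
  obtain ⟨u, hu, hau⟩ := hL.geodesic_near hH hnear p hp hi
  obtain ⟨w, hw, huw⟩ := hL.slim x y z u hu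
  have h₁ := hH.dist_triangle (u := p.getVert i) (v := u) (w := w)
  suffices ∃ b, (b ∈ q.support ∨ b ∈ r.support) ∧ H.dist w b ≤ R by
    obtain ⟨b, hb, hwb⟩ := this
    refine ⟨b, hb, ?_⟩
    have h₂ := hH.dist_triangle (u := p.getVert i) (v := w) (w := b)
    exact_mod_cast (by omega : H.dist (p.getVert i) b ≤ 4 * R + 1 + h)
  rcases hw with hw | hw
  · obtain ⟨j, -, hj⟩ := hnear r hr w hw
    exact ⟨_, Or.inr (r.getVert_mem_support j), hj⟩
  · obtain ⟨j, -, hj⟩ := hnear q.reverse (by rw [Walk.length_reverse, hq, H.dist_comm]) w hw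
    refine ⟨_, Or.inl ?_, hj⟩
    have := q.reverse.getVert_mem_support j
    rwa [Walk.support_reverse, List.mem_reverse] at this

end SimpleGraph

/-! ### Path metrics and geodesics inside a set of vertices. -/

namespace SimpleGraph

variable {α : Type*} {G : SimpleGraph α} {S T : Set α} {x y z u v : α} {m n : ℕ}

/-- There is a walk of length at most `n` from `x` to `y` inside `S`. -/
def NearIn (G : SimpleGraph α) (S : Set α) (n : ℕ) (x y : α) : Prop :=
  ∃ p : G.Walk x y, p.length ≤ n ∧ ∀ v ∈ p.support, v ∈ S

namespace NearIn

theorem refl (hx : x ∈ S) (n : ℕ) : G.NearIn S n x x :=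
  ⟨Walk.nil, Nat.zero_le _, by simpa using hx⟩

theorem left_mem (h : G.NearIn S n x y) : x ∈ S := by
  obtain ⟨p, -, hp⟩ := h
  exact hp _ p.start_mem_support

theorem right_mem (h : G.NearIn S n x y) : y ∈ S := by
  obtain ⟨p, -, hp⟩ := h
  exact hp _ p.end_mem_support

theorem symm (h : G.NearIn S n x y) : G.NearIn S n y x := by
  obtain ⟨p, hp, hS⟩ := h
  exact ⟨p.reverse, by simpa using hp, by simpa using hS⟩

theorem trans (h : G.NearIn S m x y) (h' : G.NearIn S n y z) : G.NearIn S (m + n) x z := by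
  obtain ⟨p, hp, hS⟩ := h
  obtain ⟨q, hq, hS'⟩ := h'
  refine ⟨p.append q, by rw [Walk.length_append]; omega, fun v hv => ?_⟩
  rcases (Walk.mem_support_append_iff _ _).1 hv with hv | hv
  exacts [hS v hv, hS' v hv]

theorem le (h : G.NearIn S m x y) (hmn : m ≤ n) : G.NearIn S n x y := by
  obtain ⟨p, hp, hS⟩ := h
  exact ⟨p, hp.trans hmn, hS⟩

theorem mono (h : G.NearIn S n x y) (hST : S ⊆ T) : G.NearIn T n x y := by
  obtain ⟨p, hp, hS⟩ := h
  exact ⟨p, hp, fun v hv => hST (hS v hv)⟩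

theorem of_adj (h : G.Adj x y) (hx : x ∈ S) (hy : y ∈ S) : G.NearIn S 1 x y :=
  ⟨h.toWalk, by simp, by simp [hx, hy]⟩

end NearIn

theorem Walk.length_induce (S : Set α) {x y : α} (p : G.Walk x y) (hp : ∀ v ∈ p.support, v ∈ S) :
    (p.induce S hp).length = p.length := by
  induction p with
  | nil => rfl
  | cons h p ih =>
    rw [Walk.induce_cons, Walk.length_cons, Walk.length_cons, ih]

theorem nearIn_iff_induce (hx : x ∈ S) (hy : y ∈ S) :
    G.NearIn S n x y ↔ ∃ p : (G.induce S).Walk ⟨x, hx⟩ ⟨y, hy⟩, p.length ≤ n := by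
  constructor
  · rintro ⟨p, hp, hS⟩
    exact ⟨p.induce S hS, (p.length_induce S hS).trans_le hp⟩
  · rintro ⟨p, hp⟩
    let f : G.induce S →g G := (Embedding.induce S).toHom
    refine ⟨p.map f, (Walk.length_map f p).trans_le hp, fun v hv => ?_⟩
    have hv' : v ∈ p.support.map f := (Walk.support_map f p) ▸ hv
    rw [List.mem_map] at hv'
    obtain ⟨w, -, rfl⟩ := hv'
    exact w.2

/-- The path metric of the subgraph induced on `S`. -/
noncomputable def distIn (G : SimpleGraph α) (S : Set α) (x y : α) : ℕ :=
  sInf {n | G.NearIn S n x y}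

/-- The subgraph induced on `S` is preconnected. -/
def ConnIn (G : SimpleGraph α) (S : Set α) : Prop :=
  ∀ x ∈ S, ∀ y ∈ S, ∃ n, G.NearIn S n x y

theorem NearIn.distIn_le (h : G.NearIn S n x y) : G.distIn S x y ≤ n := Nat.sInf_le h

/-- The default values agree: both sides are `0` when no walk inside `S` exists. -/
theorem distIn_eq_dist (hx : x ∈ S) (hy : y ∈ S) :
    G.distIn S x y = (G.induce S).dist ⟨x, hx⟩ ⟨y, hy⟩ := by
  by_cases h : (G.induce S).Reachable ⟨x, hx⟩ ⟨y, hy⟩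
  · obtain ⟨p, hp⟩ := h.exists_walk_length_eq_dist
    apply le_antisymm
    · exact NearIn.distIn_le ((nearIn_iff_induce hx hy).2 ⟨p, hp.le⟩)
    · have hne : {n | G.NearIn S n x y}.Nonempty :=
        ⟨_, (nearIn_iff_induce hx hy).2 ⟨p, le_rfl⟩⟩
      obtain ⟨q, hq⟩ := (nearIn_iff_induce hx hy).1 (Nat.sInf_mem hne)
      exact ((G.induce S).dist_le q).trans hq
  · rw [dist_eq_zero_of_not_reachable h, distIn]
    suffices {n | G.NearIn S n x y} = ∅ by rw [this]; exact Nat.sInf_empty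
    refine Set.eq_empty_of_forall_notMem fun n hn => ?_
    obtain ⟨p, -⟩ := (nearIn_iff_induce hx hy).1 hn
    exact h ⟨p⟩

theorem connIn_of_connected (h : (G.induce S).Connected) : G.ConnIn S := by
  intro x hx y hy
  obtain ⟨p⟩ := h.preconnected ⟨x, hx⟩ ⟨y, hy⟩
  exact ⟨p.length, (nearIn_iff_induce hx hy).2 ⟨p, le_rfl⟩⟩

theorem distIn_self (hx : x ∈ S) : G.distIn S x x = 0 :=
  Nat.le_zero.1 (NearIn.refl hx 0).distIn_le

theorem distIn_comm (x y : α) : G.distIn S x y = G.distIn S y x :=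
  congrArg sInf (Set.ext fun _ => ⟨NearIn.symm, NearIn.symm⟩)

/-- The union of the geodesics from `x` to `y` in the subgraph induced on `S`. -/
def seg (G : SimpleGraph α) (S : Set α) (x y : α) : Set α :=
  {v | v ∈ S ∧ G.distIn S x v + G.distIn S v y = G.distIn S x y}

theorem seg_comm (x y : α) : G.seg S x y = G.seg S y x := by
  ext v
  change (_ ∧ _) ↔ (_ ∧ _)
  rw [distIn_comm x v, distIn_comm v y, distIn_comm x y, add_comm]

theorem left_mem_seg (hx : x ∈ S) : x ∈ G.seg S x y :=
  ⟨hx, by rw [distIn_self hx, zero_add]⟩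

theorem right_mem_seg (hy : y ∈ S) : y ∈ G.seg S x y :=
  ⟨hy, by rw [distIn_self hy, add_zero]⟩

/-- `p` is a geodesic of the subgraph induced on `S`. -/
structure IsGeodIn (G : SimpleGraph α) (S : Set α) (p : G.Walk x y) : Prop where
  length_eq : p.length = G.distIn S x y
  support_subset : ∀ v ∈ p.support, v ∈ S

namespace ConnIn

theorem nearIn (hS : G.ConnIn S) (hx : x ∈ S) (hy : y ∈ S) :
    G.NearIn S (G.distIn S x y) x y := Nat.sInf_mem (s := {n | G.NearIn S n x y}) (hS x hx y hy)

theorem triangle (hS : G.ConnIn S) (hx : x ∈ S) (hy : y ∈ S) (hz : z ∈ S) :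
    G.distIn S x z ≤ G.distIn S x y + G.distIn S y z :=
  ((hS.nearIn hx hy).trans (hS.nearIn hy hz)).distIn_le

theorem exists_geod (hS : G.ConnIn S) (hx : x ∈ S) (hy : y ∈ S) :
    ∃ p : G.Walk x y, G.IsGeodIn S p := by
  obtain ⟨p, hp, hpS⟩ := hS.nearIn hx hy
  exact ⟨p, le_antisymm hp (NearIn.distIn_le ⟨p, le_rfl, hpS⟩), hpS⟩

theorem eq_of_distIn_eq_zero (hS : G.ConnIn S) (hx : x ∈ S) (hy : y ∈ S)
    (h : G.distIn S x y = 0) : x = y := by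
  obtain ⟨p, hp, -⟩ := hS.nearIn hx hy
  exact Walk.eq_of_length_eq_zero (p := p) (by omega)

end ConnIn

namespace IsGeodIn

variable {p : G.Walk x y}

theorem reverse (hp : G.IsGeodIn S p) : G.IsGeodIn S p.reverse :=
  ⟨by rw [Walk.length_reverse, hp.1, distIn_comm], by simpa using hp.2⟩

theorem append_left {q : G.Walk x z} {r : G.Walk z y} (h : G.IsGeodIn S (q.append r)) :
    G.IsGeodIn S q := by
  have hq : ∀ v ∈ q.support, v ∈ S := fun v hv =>
    h.2 v ((Walk.mem_support_append_iff _ _).2 (Or.inl hv))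
  have hr : ∀ v ∈ r.support, v ∈ S := fun v hv =>
    h.2 v ((Walk.mem_support_append_iff _ _).2 (Or.inr hv))
  refine ⟨le_antisymm ?_ (NearIn.distIn_le ⟨q, le_rfl, hq⟩), hq⟩
  have hne : {n | G.NearIn S n x z}.Nonempty := ⟨_, q, le_rfl, hq⟩
  have h₁ : G.NearIn S (G.distIn S x z) x z := Nat.sInf_mem hne
  have h₂ := (h₁.trans ⟨r, le_rfl, hr⟩).distIn_le
  have h₃ := h.1
  rw [Walk.length_append] at h₃
  omega

theorem append_right {q : G.Walk x z} {r : G.Walk z y} (h : G.IsGeodIn S (q.append r)) :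
    G.IsGeodIn S r := by
  have h' := h.reverse
  rw [Walk.reverse_append] at h'
  have := h'.append_left.reverse
  rwa [Walk.reverse_reverse] at this

theorem mem_seg (hp : G.IsGeodIn S p) (hv : v ∈ p.support) : v ∈ G.seg S x y := by
  obtain ⟨q, r, rfl⟩ := Walk.mem_support_iff_exists_append.1 hv
  refine ⟨hp.2 v hv, ?_⟩
  rw [← hp.append_left.1, ← hp.append_right.1, ← hp.1, Walk.length_append]

theorem nearIn_support (hp : G.IsGeodIn S p) (hu : u ∈ p.support) (hv : v ∈ p.support) :
    G.NearIn {w | w ∈ p.support} (G.distIn S u v) u v := by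
  obtain ⟨q, r, rfl⟩ := Walk.mem_support_iff_exists_append.1 hu
  rcases (Walk.mem_support_append_iff _ _).1 hv with h | h
  · obtain ⟨a, b, rfl⟩ := Walk.mem_support_iff_exists_append.1 h
    have := hp.append_left.append_right.reverse
    refine ⟨b.reverse, this.1.le, fun w hw => ?_⟩
    rw [Walk.support_reverse, List.mem_reverse] at hw
    exact (Walk.mem_support_append_iff _ _).2 (Or.inl ((Walk.mem_support_append_iff _ _).2
        (Or.inr hw)))
  · obtain ⟨a, b, rfl⟩ := Walk.mem_support_iff_exists_append.1 h
    have := hp.append_right.append_left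
    refine ⟨a, this.1.le, fun w hw => ?_⟩
    exact (Walk.mem_support_append_iff _ _).2 (Or.inr ((Walk.mem_support_append_iff _ _).2
        (Or.inl hw)))

end IsGeodIn

namespace ConnIn

theorem nearIn_of_seg_subset (hS : G.ConnIn S) (hx : x ∈ S) (hy : y ∈ S)
    (hT : G.seg S x y ⊆ T) : G.NearIn T (G.distIn S x y) x y := by
  obtain ⟨p, hp⟩ := hS.exists_geod hx hy
  exact ⟨p, hp.1.le, fun v hv => hT (hp.mem_seg hv)⟩

theorem exists_mem_seg (hS : G.ConnIn S) (hx : x ∈ S) (hy : y ∈ S)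
    (hn : n ≤ G.distIn S x y) : ∃ v ∈ G.seg S x y, G.distIn S x v = n := by
  obtain ⟨p, hp⟩ := hS.exists_geod hx hy
  refine ⟨p.getVert n, hp.mem_seg (p.getVert_mem_support n), ?_⟩
  have h := hp
  rw [← p.append_take_drop_eq n] at h
  rw [← h.append_left.1, Walk.take_length, hp.1]
  omega

theorem exists_adj_seg (hS : G.ConnIn S) (hx : x ∈ S) (hy : y ∈ S) (hne : x ≠ y) :
    ∃ v ∈ S, G.Adj x v ∧ G.distIn S v y + 1 = G.distIn S x y := by
  obtain ⟨p, hp⟩ := hS.exists_geod hx hy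
  cases p with
  | nil => exact absurd rfl hne
  | @cons _ v _ h q =>
    have hp' : G.IsGeodIn S ((h.toWalk).append q) := hp
    refine ⟨v, hp'.append_right.2 v q.start_mem_support, h, ?_⟩
    rw [← hp'.append_right.1, ← hp.1, Walk.length_cons]

theorem seg_trans (hS : G.ConnIn S) (hx : x ∈ S) (hy : y ∈ S) (hu : u ∈ G.seg S x y)
    (hv : v ∈ G.seg S x u) : v ∈ G.seg S x y := by
  have h₁ := hS.triangle hv.1 hu.1 hy
  have h₂ := hS.triangle hx hv.1 hy
  have := hu.2
  have := hv.2
  exact ⟨hv.1, by omega⟩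

end ConnIn

/-- Slimness of geodesic triangles in the subgraph induced on `S`, where one side is an arbitrary
geodesic. -/
structure SlimIn (G : SimpleGraph α) (N : ℕ) (S : Set α) : Prop where
  conn : G.ConnIn S
  slim : ∀ x ∈ S, ∀ y ∈ S, ∀ z ∈ S, ∀ p : G.Walk x z, G.IsGeodIn S p → ∀ u ∈ G.seg S x y,
    ∃ v ∈ S, (v ∈ G.seg S y z ∨ v ∈ p.support) ∧ G.distIn S u v ≤ N

theorem SlimIn.slim_seg {N : ℕ} (h : G.SlimIn N S) (hx : x ∈ S) (hy : y ∈ S) (hz : z ∈ S)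
    (hu : u ∈ G.seg S x y) :
    ∃ v ∈ S, (v ∈ G.seg S y z ∨ v ∈ G.seg S x z) ∧ G.distIn S u v ≤ N := by
  obtain ⟨p, hp⟩ := h.conn.exists_geod hx hz
  obtain ⟨v, hv, hv', huv⟩ := h.slim x hx y hy z hz p hp u hu
  exact ⟨v, hv, hv'.imp_right fun h => hp.mem_seg h, huv⟩

theorem slimIn_of_isHyperbolicGraph {N : ℕ} (h : IsHyperbolicGraph N (G.induce S)) :
    G.SlimIn N S := by
  have hS := connIn_of_connected h.1
  refine ⟨hS, fun x hx y hy z hz p hp u hu => ?_⟩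
  have hlen : ∀ {a b : α} (q : G.Walk a b) (hq : G.IsGeodIn S q),
      (q.induce S hq.2).length = (G.induce S).dist ⟨a, hq.2 _ q.start_mem_support⟩
        ⟨b, hq.2 _ q.end_mem_support⟩ := by
    intro a b q hq
    rw [Walk.length_induce, hq.1]
    exact distIn_eq_dist _ _
  obtain ⟨q, hq⟩ := hS.exists_geod hy hz
  obtain ⟨r₁, hr₁⟩ := hS.exists_geod hx hu.1
  obtain ⟨r₂, hr₂⟩ := hS.exists_geod hu.1 hy
  -- A point of the segment lies on an actual geodesic, the concatenation through `u`.
  have hr : G.IsGeodIn S (r₁.append r₂) := by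
    refine ⟨by rw [Walk.length_append, hr₁.1, hr₂.1, hu.2], fun v hv => ?_⟩
    rcases (Walk.mem_support_append_iff _ _).1 hv with hv | hv
    exacts [hr₁.2 v hv, hr₂.2 v hv]
  obtain ⟨b, hb, hub⟩ := h.2 _ _ _ _ _ _ (hlen _ hr) (hlen _ hq) (hlen _ hp) ⟨u, hu.1⟩
    (by simp)
  refine ⟨b.1, b.2, ?_, ?_⟩
  · rw [Walk.support_induce, Walk.support_induce] at hb
    simp only [List.mem_attachWith] at hb
    exact hb.imp_left fun h => hq.mem_seg h
  · rw [distIn_eq_dist hu.1 b.2]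
    exact_mod_cast hub

theorem isHyperbolicGraph_mono {δ δ' : ℝ} {G : SimpleGraph α} (h : IsHyperbolicGraph δ G)
    (hle : δ ≤ δ') : IsHyperbolicGraph δ' G :=
  ⟨h.1, fun x y z p q r hp hq hr a ha =>
    let ⟨b, hb, hab⟩ := h.2 x y z p q r hp hq hr a ha
    ⟨b, hb, hab.trans hle⟩⟩

theorem exists_hyperbolic_of_slim_sets (h : ℕ) :
    ∃ N : ℕ, ∀ (α : Type*) (G : SimpleGraph α) (S : Set α) (L : α → α → Set α), S.Nonempty →
      (∀ x ∈ S, ∀ y ∈ S, ∃ n, G.NearIn (S ∩ L x y) n x y) →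
      (∀ x ∈ S, ∀ y ∈ S, (x = y ∨ G.Adj x y) → ∀ v ∈ S, v ∈ L x y → G.NearIn S h v x) →
      (∀ x ∈ S, ∀ y ∈ S, ∀ z ∈ S, ∀ v ∈ S, v ∈ L x y →
        ∃ w, (w ∈ L x z ∨ w ∈ L z y) ∧ G.NearIn S h v w) →
      IsHyperbolicGraph N (G.induce S) := by
  obtain ⟨N, hN⟩ := exists_hyperbolic_of_isSlimFamily h
  refine ⟨N, fun α G S L hne hwalk hsmall hslim => ?_⟩
  have : Nonempty S := hne.to_subtype
  have hconn : (G.induce S).Connected := by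
    refine ⟨fun x y => ?_⟩
    obtain ⟨n, hn⟩ := hwalk x x.2 y y.2
    obtain ⟨p, -⟩ := (nearIn_iff_induce x.2 y.2).1 (hn.mono Set.inter_subset_left)
    exact ⟨p⟩
  refine hN S (G.induce S) (fun x y => {v | v.1 ∈ L x y}) ⟨fun x y => ?_, fun x y hxy v hv => ?_,
    fun x y z v hv => ?_⟩
  · obtain ⟨n, p, -, hp⟩ := hwalk x x.2 y y.2
    refine ⟨p.induce S fun v hv => (hp v hv).1, fun v hv => (hp v ?_).2⟩
    rw [Walk.support_induce] at hv
    simpa using hv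
  · have hxy' : x.1 = y.1 ∨ G.Adj x y := by
      rcases Nat.le_one_iff_eq_zero_or_eq_one.1 hxy with h0 | h1
      · exact Or.inl (congrArg _ (hconn.dist_eq_zero_iff.1 h0))
      · exact Or.inr (induce_adj.1 (dist_eq_one_iff_adj.1 h1))
    rw [← distIn_eq_dist v.2 x.2]
    exact (hsmall x x.2 y y.2 hxy' v v.2 hv).distIn_le
  · obtain ⟨w, hw, hvw⟩ := hslim x x.2 y y.2 z z.2 v v.2 hv
    refine ⟨⟨w, hvw.right_mem⟩, hw, ?_⟩
    rw [← distIn_eq_dist v.2 hvw.right_mem]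
    exact hvw.distIn_le

end SimpleGraph

/-! ### Removing cone points from a hyperbolic graph. -/

namespace SimpleGraph

variable {α : Type*} {G : SimpleGraph α} {A B : Set α} {C : α → Set α} {N : ℕ}
  {a a' b p q u v x y z : α}

/-- The neighbours of `b` at which geodesics from `x` to `b` inside `A` enter `b`. -/
def proj (G : SimpleGraph α) (A : Set α) (b x : α) : Set α :=
  {a | a ∈ A ∧ G.Adj a b ∧ G.distIn A x a + 1 = G.distIn A x b}

namespace ConnIn

theorem proj_nonempty (hA : G.ConnIn A) (hb : b ∈ A) (hx : x ∈ A) (hne : x ≠ b) :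
    (G.proj A b x).Nonempty := by
  obtain ⟨a, ha, hab, h⟩ := hA.exists_adj_seg hb hx hne.symm
  exact ⟨a, ha, hab.symm, by rw [distIn_comm x a, distIn_comm x b, h]⟩

theorem mem_seg_of_mem_proj (hA : G.ConnIn A) (hb : b ∈ G.seg A x y) (hx : x ∈ A) (hy : y ∈ A)
    (ha : a ∈ G.proj A b x) : a ∈ G.seg A x y := by
  have h₁ := (NearIn.of_adj ha.2.1 ha.1 hb.1).distIn_le
  have h₂ := hA.triangle ha.1 hb.1 hy
  have h₃ := hA.triangle hx ha.1 hy
  have := ha.2.2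
  have := hb.2
  exact ⟨ha.1, by omega⟩

/-- A geodesic from `u` to `b` extends backwards to one from `x` to `b` that enters `b` at the same
neighbour. -/
theorem proj_subset (hA : G.ConnIn A) (hx : x ∈ A) (hy : y ∈ A) (hu : u ∈ G.seg A x y)
    (hb : b ∈ G.seg A u y) : G.proj A b u ⊆ G.proj A b x := by
  intro a ha
  have h₁ := hA.triangle hx hu.1 ha.1
  have h₂ := hA.triangle hx hu.1 hb.1
  have h₃ := hA.triangle hx hb.1 hy
  have h₄ := (NearIn.of_adj ha.2.1 ha.1 hb.1).distIn_le
  have h₅ := hA.triangle hx ha.1 hb.1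
  have := ha.2.2
  have := hu.2
  have := hb.2
  exact ⟨ha.1, ha.2.1, by omega⟩

theorem seg_trans_right (hA : G.ConnIn A) (hx : x ∈ A) (hy : y ∈ A) (hu : u ∈ G.seg A x y)
    (hv : v ∈ G.seg A u y) : v ∈ G.seg A x y := by
  rw [seg_comm] at hu hv ⊢
  exact hA.seg_trans hy hx hu hv

theorem nearIn_diff (hA : G.ConnIn A) (hx : x ∈ A) (hy : y ∈ A) (hb : b ∉ G.seg A x y) :
    G.NearIn (A \ {b}) (G.distIn A x y) x y :=
  hA.nearIn_of_seg_subset hx hy fun v hv => ⟨hv.1, by rintro rfl; exact hb hv⟩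

/-- Otherwise the route from `x` to `y` through `b` would be shorter than a geodesic by twice the
distance from `p` to `b`. -/
theorem not_mem_seg_inter (hA : G.ConnIn A) (hx : x ∈ A) (hy : y ∈ A) (hp : p ∈ G.seg A x y)
    (hbA : b ∈ A) (hpb : p ≠ b) : b ∉ G.seg A x p ∨ b ∉ G.seg A p y := by
  by_contra! h
  obtain ⟨h₁, h₂⟩ := h
  refine hpb (hA.eq_of_distIn_eq_zero hp.1 hbA ?_)
  have h₃ := hA.triangle hx hbA hy
  have := hp.2
  have := h₁.2
  have := h₂.2
  have := G.distIn_comm (S := A) b p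
  omega

end ConnIn

namespace SlimIn

/-- A point `u` of `[x, a]` at distance `2N + 3` from `a` is at least `2N + 4` from `b`. Two slim
triangles, `x a a'` and then `x a' y`, move it by at most `2N`, too little to meet `b`. It cannot
land on `[a, a']`, which has length at most 2. -/
theorem exists_near_proj (hA : G.SlimIn N A) (hb : b ∈ A) (hx : x ∈ A) (hy : y ∈ A)
    (γ : G.Walk x y) (hγ : G.IsGeodIn A γ) (ha : a ∈ G.proj A b x) (ha' : a' ∈ G.proj A b y) :
    ∃ v, G.NearIn (A \ {b}) (4 * N + 3) a v ∧ (v ∈ γ.support ∨ v ∈ G.seg A a' y) := by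
  have hc := hA.conn
  have hxa := ha.2.2
  by_cases hs : G.distIn A x a ≤ 2 * N + 3
  · refine ⟨x, ((hc.nearIn_diff hx ha.1 fun h => ?_).symm.le
      (by omega)), Or.inl γ.start_mem_support⟩
    have := h.2
    omega
  obtain ⟨u, hu, hxu⟩ := hc.exists_mem_seg hx ha.1 (n := G.distIn A x a - (2 * N + 3)) (by omega)
  have hua := hu.2
  have hub := hc.triangle hx hu.1 hb
  obtain ⟨v₁, hv₁, hv₁', huv₁⟩ := hA.slim_seg hx ha.1 ha'.1 hu
  rcases hv₁' with hv₁' | hv₁'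
  · exfalso
    have h₁ := (NearIn.of_adj ha.2.1 ha.1 hb).distIn_le
    have h₂ := (NearIn.of_adj ha'.2.1 ha'.1 hb).distIn_le
    have h₃ := hc.triangle ha.1 hb ha'.1
    have h₄ := hc.triangle hu.1 hv₁ ha.1
    have := hv₁'.2
    rw [distIn_comm b a'] at h₃
    rw [distIn_comm v₁ a] at h₄
    omega
  obtain ⟨v, hv, hv', hv₁v⟩ := hA.slim x hx a' ha'.1 y hy γ hγ v₁ hv₁'
  have h₁ : b ∉ G.seg A u v₁ := fun h => by
    have := h.2
    omega
  have h₂ : b ∉ G.seg A v₁ v := fun h => by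
    have := h.2
    have := hc.triangle hu.1 hv₁ hb
    omega
  have h₃ : b ∉ G.seg A u a := fun h => by
    have := h.2
    omega
  refine ⟨v, ?_, hv'.symm⟩
  exact ((hc.nearIn_diff hu.1 ha.1 h₃).symm.trans ((hc.nearIn_diff hu.1 hv₁ h₁).trans
    (hc.nearIn_diff hv₁ hv h₂))).le (by omega)

/-- Geodesics avoiding a vertex have coarsely constant projection to it. -/
theorem nearIn_of_mem_proj (hA : G.SlimIn N A) (hb : b ∈ A) (hx : x ∈ A) (hy : y ∈ A)
    (hbs : b ∉ G.seg A x y) (ha : a ∈ G.proj A b x) (ha' : a' ∈ G.proj A b y) :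
    G.NearIn (A \ {b}) (16 * N + 14) a a' := by
  have hc := hA.conn
  have hab := (NearIn.of_adj ha.2.1 ha.1 hb).distIn_le
  have ha'b := (NearIn.of_adj ha'.2.1 ha'.1 hb).distIn_le
  have haa' := hc.triangle ha.1 hb ha'.1
  rw [distIn_comm b a'] at haa'
  -- Geodesics from `a'` to `y` avoid `b`, because `a'` is closer to `y` than `b` is.
  have hkey : ∀ {y a a' v : α}, y ∈ A → a ∈ A → a' ∈ G.proj A b y → G.distIn A a a' ≤ 2 →
      G.NearIn (A \ {b}) (4 * N + 3) a v → v ∈ G.seg A a' y →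
      G.NearIn (A \ {b}) (16 * N + 14) a a' := by
    intro y a a' v hy ha ha' haa' hav hv
    have h₁ : b ∉ G.seg A v a' := fun h => by
      have h₂ := h.2
      have h₃ := hv.2
      have h₄ := ha'.2.2
      have h₅ := hc.triangle hy hv.1 hb
      rw [distIn_comm y a'] at h₄
      rw [distIn_comm y v] at h₅
      rw [distIn_comm v a'] at h₂
      omega
    have h₂ := (hav.mono Set.sdiff_subset).symm.distIn_le
    have h₃ := hc.triangle hv.1 ha ha'.1
    exact (hav.trans (hc.nearIn_diff hv.1 ha'.1 h₁)).le (by omega)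
  obtain ⟨γ, hγ⟩ := hc.exists_geod hx hy
  obtain ⟨v, hav, hv⟩ := hA.exists_near_proj hb hx hy γ hγ ha ha'
  obtain ⟨v', hav', hv'⟩ := hA.exists_near_proj hb hy hx γ.reverse hγ.reverse ha' ha
  rcases hv with hv | hv
  -- If both near points lie on `γ`, the part of `γ` between them avoids `b` and has length at most
  -- `2(4N + 3) + 2`. This is where slimness with a prescribed geodesic as a side is needed.
  · rcases hv' with hv' | hv'
    · rw [Walk.support_reverse, List.mem_reverse] at hv'
      have h₁ := (hav.mono Set.sdiff_subset).symm.distIn_le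
      have h₂ := (hav'.mono Set.sdiff_subset).distIn_le
      have h₃ := hc.triangle (hγ.2 v hv) ha.1 ha'.1
      have h₄ := hc.triangle (hγ.2 v hv) ha'.1 (hγ.2 v' hv')
      refine ((hav.trans ((hγ.nearIn_support hv hv').mono fun w hw => ⟨hγ.2 w hw, ?_⟩)).trans
        hav'.symm).le (by omega)
      rintro rfl
      exact hbs (hγ.mem_seg hw)
    · exact (hkey hx ha'.1 ha (by rw [distIn_comm]; omega) hav' hv').symm
  · exact hkey hy ha.1 ha' (by omega) hav hv

end SlimIn

/-- The vertices in `B` are cone points of the slim graph induced on `A`; the base of the cone at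
`b` lies in the slim subgraph `C b`, which is quasi-isometrically embedded away from `b`. -/
structure IsConeFamily (G : SimpleGraph α) (A B : Set α) (C : α → Set α) (N : ℕ) : Prop where
  slim : G.SlimIn N A
  subset : B ⊆ A
  base_subset : ∀ b ∈ B, C b ⊆ A \ B
  adj_mem : ∀ b ∈ B, ∀ a ∈ A, G.Adj a b → a ∈ C b
  base_slim : ∀ b ∈ B, G.SlimIn N (C b)
  base_embed : ∀ b ∈ B, ∀ x ∈ C b, ∀ y ∈ C b, ∀ n,
    G.NearIn (A \ {b}) n x y → G.NearIn (C b) (N * n + N) x y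

/-- Geodesics in `A`, with passages through cone points replaced by geodesics in the bases. -/
def deconedSeg (G : SimpleGraph α) (A B : Set α) (C : α → Set α) (x y : α) : Set α :=
  {v | (v ∈ G.seg A x y ∧ v ∉ B) ∨ ∃ b ∈ B, b ∈ G.seg A x y ∧
    ∃ a ∈ G.proj A b x, ∃ a' ∈ G.proj A b y, v ∈ G.seg (C b) a a'}

theorem deconedSeg_comm (x y : α) : G.deconedSeg A B C x y = G.deconedSeg A B C y x := by
  have key : ∀ x y : α, G.deconedSeg A B C x y ⊆ G.deconedSeg A B C y x := by
    rintro x y v (⟨hv, hvB⟩ | ⟨b, hb, hbs, a, ha, a', ha', hv⟩)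
    · exact Or.inl ⟨by rwa [seg_comm], hvB⟩
    · exact Or.inr ⟨b, hb, by rwa [seg_comm], a', ha', a, ha, by rwa [seg_comm]⟩
  exact (key x y).antisymm (key y x)

namespace IsConeFamily

theorem mem_base (h : G.IsConeFamily A B C N) (hb : b ∈ B) (ha : a ∈ G.proj A b x) : a ∈ C b :=
  h.adj_mem b hb a ha.1 ha.2.1

theorem proj_nonempty (h : G.IsConeFamily A B C N) (hb : b ∈ B) (hx : x ∈ A \ B) :
    (G.proj A b x).Nonempty :=
  h.slim.conn.proj_nonempty (h.subset hb) hx.1 (by rintro rfl; exact hx.2 hb)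

theorem nearIn_base {E : ℕ} (h : G.IsConeFamily A B C N) (hE : N * (16 * N + 14) + N ≤ E)
    (hb : b ∈ B) (hx : x ∈ A) (hy : y ∈ A) (hbs : b ∉ G.seg A x y) (ha : a ∈ G.proj A b x)
    (ha' : a' ∈ G.proj A b y) : G.NearIn (C b) E a a' :=
  (h.base_embed b hb a (h.mem_base hb ha) a' (h.mem_base hb ha') _
    (h.slim.nearIn_of_mem_proj (h.subset hb) hx hy hbs ha ha')).le hE

theorem deconedSeg_subset (h : G.IsConeFamily A B C N) (hx : x ∈ A) (hy : y ∈ A)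
    (hu : u ∈ G.seg A x y) : G.deconedSeg A B C u y ⊆ G.deconedSeg A B C x y := by
  have hc := h.slim.conn
  rintro v (⟨hv, hvB⟩ | ⟨b, hb, hbs, a, ha, a', ha', hv⟩)
  · exact Or.inl ⟨hc.seg_trans_right hx hy hu hv, hvB⟩
  · exact Or.inr ⟨b, hb, hc.seg_trans_right hx hy hu hbs, a, hc.proj_subset hx hy hu hbs ha, a',
      ha', hv⟩

/-- Neighbours of a cone point lie in its base, hence outside `B`. A geodesic thus advances by one
edge outside `B` or by two edges across a single cone point. -/
theorem exists_next (h : G.IsConeFamily A B C N) (hx : x ∈ A \ B) (hy : y ∈ A \ B) (hne : x ≠ y) :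
    (∃ u ∈ A \ B, G.Adj x u ∧ u ∈ G.seg A x y ∧ G.distIn A u y + 1 = G.distIn A x y) ∨
    ∃ b ∈ B, b ∈ G.seg A x y ∧ x ∈ G.proj A b x ∧ ∃ u ∈ A \ B, u ∈ G.proj A b y ∧
      u ∈ G.seg A x y ∧ G.distIn A u y + 2 = G.distIn A x y := by
  have hc := h.slim.conn
  obtain ⟨v, hv, hxv, hvy⟩ := hc.exists_adj_seg hx.1 hy.1 hne
  have hxv' := (NearIn.of_adj hxv hx.1 hv).distIn_le
  have htri := hc.triangle hx.1 hv hy.1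
  have hvs : v ∈ G.seg A x y := ⟨hv, by omega⟩
  by_cases hvB : v ∈ B
  · obtain ⟨u, hu, hvu, huy⟩ := hc.exists_adj_seg hv hy.1 (by rintro rfl; exact hy.2 hvB)
    have huB : u ∈ A \ B := h.base_subset v hvB (h.adj_mem v hvB u hu hvu.symm)
    have hvu' := (NearIn.of_adj hvu hv hu).distIn_le
    have htri' := hc.triangle hv hu hy.1
    refine Or.inr ⟨v, hvB, hvs, ⟨hx.1, hxv, ?_⟩, u, huB, ⟨hu, hvu.symm, ?_⟩, ?_, by omega⟩
    · rw [distIn_self hx.1]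
      omega
    · rw [distIn_comm y u, distIn_comm y v]
      omega
    · exact hc.seg_trans_right hx.1 hy.1 hvs ⟨hu, by omega⟩
  · exact Or.inl ⟨v, ⟨hv, hvB⟩, hxv, hvs, hvy⟩

theorem exists_walk (h : G.IsConeFamily A B C N) (m : ℕ) :
    ∀ x ∈ A \ B, ∀ y ∈ A \ B, G.distIn A x y ≤ m →
      ∃ n, G.NearIn ((A \ B) ∩ G.deconedSeg A B C x y) n x y := by
  induction m using Nat.strong_induction_on with
  | _ m ih =>
  intro x hx y hy hm
  have hxs : x ∈ (A \ B) ∩ G.deconedSeg A B C x y := ⟨hx, Or.inl ⟨left_mem_seg hx.1, hx.2⟩⟩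
  by_cases hne : x = y
  · subst hne
    exact ⟨0, NearIn.refl hxs 0⟩
  have hmono : ∀ {u : α}, u ∈ G.seg A x y → (A \ B) ∩ G.deconedSeg A B C u y ⊆
      (A \ B) ∩ G.deconedSeg A B C x y := fun hu =>
    Set.inter_subset_inter_right _ (h.deconedSeg_subset hx.1 hy.1 hu)
  rcases h.exists_next hx hy hne with ⟨u, hu, hxu, hus, huy⟩ | ⟨b, hb, hbs, hxp, u, hu, hup, hus,
      huy⟩
  · obtain ⟨n, hn⟩ := ih (G.distIn A u y) (by omega) u hu y hy le_rfl
    have hn' := hn.mono (hmono hus)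
    exact ⟨_, (NearIn.of_adj hxu hxs hn'.left_mem).trans hn'⟩
  · obtain ⟨n, hn⟩ := ih (G.distIn A u y) (by omega) u hu y hy le_rfl
    have hn' := hn.mono (hmono hus)
    have hsub : G.seg (C b) x u ⊆ (A \ B) ∩ G.deconedSeg A B C x y := fun v hv =>
      ⟨h.base_subset b hb hv.1, Or.inr ⟨b, hb, hbs, x, hxp, u, hup, hv⟩⟩
    exact ⟨_, ((h.base_slim b hb).conn.nearIn_of_seg_subset (h.mem_base hb hxp)
      (h.mem_base hb hup) hsub).trans hn'⟩

/-- Replace passages through cone points by base paths of length at most `T`, stopping at the first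
one where this is impossible. -/
theorem near_or_deep (h : G.IsConeFamily A B C N) (T m : ℕ) :
    ∀ x ∈ A \ B, ∀ y ∈ A \ B, G.distIn A x y ≤ m →
      G.NearIn (A \ B) ((T + 1) * m) x y ∨ ∃ b ∈ B, b ∈ G.seg A x y ∧
        ∃ a ∈ G.proj A b x, ∃ a' ∈ G.proj A b y, ¬ G.NearIn (C b) T a a' ∧
          G.NearIn (A \ B) ((T + 1) * m) x a := by
  induction m using Nat.strong_induction_on with
  | _ m ih =>
  intro x hx y hy hm
  have hc := h.slim.conn
  by_cases hne : x = y
  · subst hne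
    exact Or.inl (NearIn.refl hx _)
  have hstep : ∀ {u : α} {j i : ℕ}, u ∈ A \ B → G.NearIn (A \ B) j x u → u ∈ G.seg A x y →
      G.distIn A u y + i = G.distIn A x y → 0 < i → j ≤ (T + 1) * i →
      G.NearIn (A \ B) ((T + 1) * m) x y ∨ ∃ b ∈ B, b ∈ G.seg A x y ∧
        ∃ a ∈ G.proj A b x, ∃ a' ∈ G.proj A b y, ¬ G.NearIn (C b) T a a' ∧
          G.NearIn (A \ B) ((T + 1) * m) x a := by
    intro u j i hu hxu hus hdist hi hj
    obtain ⟨m', rfl⟩ : ∃ m', m = m' + i := ⟨m - i, by omega⟩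
    have hle : j + (T + 1) * m' ≤ (T + 1) * (m' + i) := by rw [mul_add]; omega
    rcases ih m' (by omega) u hu y hy (by omega) with hn | ⟨b, hb, hbs, a, ha, a', ha', hT, hn⟩
    · exact Or.inl ((hxu.trans hn).le hle)
    · exact Or.inr ⟨b, hb, hc.seg_trans_right hx.1 hy.1 hus hbs, a,
        hc.proj_subset hx.1 hy.1 hus hbs ha, a', ha', hT, (hxu.trans hn).le hle⟩
  rcases h.exists_next hx hy hne with ⟨u, hu, hxu, hus, huy⟩ | ⟨b, hb, hbs, hxp, u, hu, hup, hus,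
      huy⟩
  · exact hstep hu (NearIn.of_adj hxu hx hu) hus huy one_pos (by omega)
  · by_cases hT : G.NearIn (C b) T x u
    · exact hstep hu (hT.mono (h.base_subset b hb)) hus huy two_pos (by omega)
    · exact Or.inr ⟨b, hb, hbs, x, hxp, u, hup, hT, NearIn.refl hx _⟩

variable {E : ℕ}

/-- If `[x, z]` misses `b`, then `a` is `E`-close to the projection of `z`, an endpoint of the base
segment inserted in `[y, z]`. -/
theorem exists_near_deconedSeg_of_mem_proj (h : G.IsConeFamily A B C N)
    (hE : N * (16 * N + 14) + N ≤ E) (hx : x ∈ A \ B) (hy : y ∈ A \ B) (hz : z ∈ A \ B)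
    (hb : b ∈ B) (hbs : b ∈ G.seg A x z ∨ b ∈ G.seg A y z) (ha : a ∈ G.proj A b x) :
    ∃ v, (v ∈ G.deconedSeg A B C x z ∨ v ∈ G.deconedSeg A B C y z) ∧
      G.NearIn (A \ B) E a v := by
  have haC := h.mem_base hb ha
  obtain ⟨c, hc⟩ := h.proj_nonempty hb hz
  have hcC := h.mem_base hb hc
  by_cases hxz : b ∈ G.seg A x z
  · exact ⟨a, Or.inl (Or.inr ⟨b, hb, hxz, a, ha, c, hc, left_mem_seg haC⟩),
      NearIn.refl (h.base_subset b hb haC) _⟩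
  · have hyz : b ∈ G.seg A y z := hbs.resolve_left hxz
    obtain ⟨d, hd⟩ := h.proj_nonempty hb hy
    exact ⟨c, Or.inr (Or.inr ⟨b, hb, hyz, d, hd, c, hc, right_mem_seg hcC⟩),
      (h.nearIn_base hE hb hx.1 hz.1 hxz ha hc).mono (h.base_subset b hb)⟩

/-- Only a deep passage at some `b` between `p` and `q` can separate them once `B` is removed. In
that case `p` is close to the projection to `b` of `x` or `y`, and hence to another side if that
side passes through `b`. -/
theorem slim_of_near_left (h : G.IsConeFamily A B C N) (hE : N * (16 * N + 14) + N ≤ E)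
    (hx : x ∈ A \ B) (hy : y ∈ A \ B) (hz : z ∈ A \ B) (hp : p ∈ G.seg A x y) (hpB : p ∉ B)
    (hq : q ∈ G.seg A x z) (hqB : q ∉ B) (hpq : G.distIn A p q ≤ N + 1) :
    ∃ v, (v ∈ G.deconedSeg A B C x z ∨ v ∈ G.deconedSeg A B C y z) ∧
      G.NearIn (A \ B) ((4 * E + 1) * (N + 1) + 2 * E) p v := by
  have hcA := h.slim.conn
  rcases h.near_or_deep (4 * E) (N + 1) p ⟨hp.1, hpB⟩ q ⟨hq.1, hqB⟩ hpq with
    hn | ⟨b, hb, -, a, ha, a', ha', hT, hn⟩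
  · exact ⟨q, Or.inl (Or.inl ⟨hq, hqB⟩), hn.le (by omega)⟩
  have hsub := h.base_subset b hb
  obtain ⟨ax, hax⟩ := h.proj_nonempty hb hx
  obtain ⟨ay, hay⟩ := h.proj_nonempty hb hy
  obtain ⟨az, haz⟩ := h.proj_nonempty hb hz
  have hpb : p ≠ b := by rintro rfl; exact hpB hb
  have hsplit := hcA.not_mem_seg_inter hx.1 hy.1 hp (h.subset hb) hpb
  by_cases hbs : b ∈ G.seg A x z ∨ b ∈ G.seg A y z
  · rcases hsplit with hs | hs
    · obtain ⟨v, hv, hav⟩ := h.exists_near_deconedSeg_of_mem_proj hE hx hy hz hb hbs hax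
      exact ⟨v, hv, ((hn.trans ((h.nearIn_base hE hb hx.1 hp.1 hs hax ha).symm.mono hsub)).trans
        hav).le (by omega)⟩
    · obtain ⟨v, hv, hav⟩ := h.exists_near_deconedSeg_of_mem_proj hE hy hx hz hb hbs.symm hay
      exact ⟨v, hv.symm, ((hn.trans ((h.nearIn_base hE hb hp.1 hy.1 hs ha hay).mono hsub)).trans
        hav).le (by omega)⟩
  -- When neither other side meets `b`, the projections of `p` and `q` are joined by at most four
  -- moves of size `E`, against the depth `4 * E`.
  · exfalso
    rw [not_or] at hbs
    have hxq : b ∉ G.seg A x q := fun hb' => hbs.1 (hcA.seg_trans hx.1 hz.1 hq hb')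
    have h₁ := h.nearIn_base hE hb hx.1 hq.1 hxq hax ha'
    rcases hsplit with hs | hs
    · exact hT (((h.nearIn_base hE hb hx.1 hp.1 hs hax ha).symm.trans h₁).le (by omega))
    · have h₂ := h.nearIn_base hE hb hp.1 hy.1 hs ha hay
      have h₃ := h.nearIn_base hE hb hy.1 hz.1 hbs.2 hay haz
      have h₄ := (h.nearIn_base hE hb hx.1 hz.1 hbs.1 hax haz).symm
      exact hT ((((h₂.trans h₃).trans h₄).trans h₁).le (by omega))

theorem slim_of_mem_seg (h : G.IsConeFamily A B C N) (hE : N * (16 * N + 14) + N ≤ E)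
    (hx : x ∈ A \ B) (hy : y ∈ A \ B) (hz : z ∈ A \ B) (hp : p ∈ G.seg A x y) (hpB : p ∉ B) :
    ∃ v, (v ∈ G.deconedSeg A B C x z ∨ v ∈ G.deconedSeg A B C y z) ∧
      G.NearIn (A \ B) ((4 * E + 1) * (N + 1) + 2 * E) p v := by
  have hcA := h.slim.conn
  -- The point supplied by slimness may be a cone point. The next vertex towards `z` is not, whence
  -- `N + 1`.
  have hmove : ∀ {w q : α}, w ∈ A → q ∈ G.seg A w z → G.distIn A p q ≤ N →
      ∃ q', q' ∈ G.seg A w z ∧ q' ∉ B ∧ G.distIn A p q' ≤ N + 1 := by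
    intro w q hw hq hpq
    by_cases hqB : q ∈ B
    · obtain ⟨q', hq', hadj, hd⟩ :=
        hcA.exists_adj_seg hq.1 hz.1 (by rintro rfl; exact hz.2 hqB)
      have h₁ := (NearIn.of_adj hadj hq.1 hq').distIn_le
      have h₂ := hcA.triangle hq.1 hq' hz.1
      have h₃ := hcA.triangle hp.1 hq.1 hq'
      exact ⟨q', hcA.seg_trans_right hw hz.1 hq ⟨hq', by omega⟩,
        (h.base_subset q hqB (h.adj_mem q hqB q' hq' hadj.symm)).2, by omega⟩
    · exact ⟨q, hq, hqB, by omega⟩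
  obtain ⟨q, -, hq | hq, hpq⟩ := h.slim.slim_seg hx.1 hy.1 hz.1 hp
  · obtain ⟨q', hq', hqB, hpq'⟩ := hmove hy.1 hq hpq
    rw [seg_comm] at hp
    obtain ⟨v, hv, hpv⟩ := h.slim_of_near_left hE hy hx hz hp hpB hq' hqB hpq'
    exact ⟨v, hv.symm, hpv⟩
  · obtain ⟨q', hq', hqB, hpq'⟩ := hmove hx.1 hq hpq
    exact h.slim_of_near_left hE hx hy hz hp hpB hq' hqB hpq'

/-- If another side passes through `b`, use the slim triangle in the base spanned by the three
projections. Otherwise `[a, a']` has length at most `2 * E`, and `p` may be replaced by `a`, which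
lies on the original segment. -/
theorem slim_of_mem_base_seg (h : G.IsConeFamily A B C N) (hE : N * (16 * N + 14) + N ≤ E)
    (hx : x ∈ A \ B) (hy : y ∈ A \ B) (hz : z ∈ A \ B) (hb : b ∈ B) (hbs : b ∈ G.seg A x y)
    (ha : a ∈ G.proj A b x) (ha' : a' ∈ G.proj A b y) (hp : p ∈ G.seg (C b) a a') :
    ∃ v, (v ∈ G.deconedSeg A B C x z ∨ v ∈ G.deconedSeg A B C y z) ∧
      G.NearIn (A \ B) ((4 * E + 1) * (N + 1) + 4 * E + N) p v := by
  have hsub := h.base_subset b hb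
  have hCb := h.base_slim b hb
  have haC := h.mem_base hb ha
  have ha'C := h.mem_base hb ha'
  obtain ⟨c, hc⟩ := h.proj_nonempty hb hz
  have hcC := h.mem_base hb hc
  by_cases hbs' : b ∈ G.seg A x z ∨ b ∈ G.seg A y z
  · have hend : ∀ {x y a q : α}, x ∈ A \ B → y ∈ A \ B → (b ∈ G.seg A x z ∨ b ∈ G.seg A y z) →
        a ∈ G.proj A b x → q ∈ G.seg (C b) a c → G.distIn (C b) p q ≤ N →
        ∃ v, (v ∈ G.deconedSeg A B C x z ∨ v ∈ G.deconedSeg A B C y z) ∧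
          G.NearIn (A \ B) ((4 * E + 1) * (N + 1) + 4 * E + N) p v := by
      intro x y a q hx hy hbs' ha hq hpq
      have hpq' : G.NearIn (A \ B) N p q := ((hCb.conn.nearIn hp.1 hq.1).le hpq).mono hsub
      by_cases hxz : b ∈ G.seg A x z
      · exact ⟨q, Or.inl (Or.inr ⟨b, hb, hxz, a, ha, c, hc, hq⟩), hpq'.le (by omega)⟩
      · have hac := (h.nearIn_base hE hb hx.1 hz.1 hxz ha hc).distIn_le
        have hqa : G.NearIn (A \ B) E q a :=
          ((hCb.conn.nearIn (h.mem_base hb ha) hq.1).symm.le (by have := hq.2; omega)).mono hsub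
        obtain ⟨v, hv, hav⟩ := h.exists_near_deconedSeg_of_mem_proj hE hx hy hz hb hbs' ha
        exact ⟨v, hv, ((hpq'.trans hqa).trans hav).le (by omega)⟩
    obtain ⟨q, -, hq | hq, hpq⟩ := hCb.slim_seg haC ha'C hcC hp
    · obtain ⟨v, hv, hpv⟩ := hend hy hx hbs'.symm ha' hq hpq
      exact ⟨v, hv.symm, hpv⟩
    · exact hend hx hy hbs' ha hq hpq
  · rw [not_or] at hbs'
    have h₁ := ((h.nearIn_base hE hb hx.1 hz.1 hbs'.1 ha hc).trans
      (h.nearIn_base hE hb hy.1 hz.1 hbs'.2 ha' hc).symm).distIn_le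
    have hpa : G.NearIn (A \ B) (2 * E) p a :=
      ((hCb.conn.nearIn haC hp.1).symm.le (by have := hp.2; omega)).mono hsub
    obtain ⟨v, hv, hav⟩ := h.slim_of_mem_seg hE hx hy hz
      (h.slim.conn.mem_seg_of_mem_proj hbs hx.1 hy.1 ha) (hsub haC).2
    exact ⟨v, hv, (hpa.trans hav).le (by omega)⟩

theorem deconedSeg_small (h : G.IsConeFamily A B C N) (hx : x ∈ A \ B) (hy : y ∈ A \ B)
    (hxy : x = y ∨ G.Adj x y) (hv : v ∈ G.deconedSeg A B C x y) : G.NearIn (A \ B) 1 v x := by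
  have hcA := h.slim.conn
  have hseg : ∀ {u : α}, u ∈ G.seg A x y → u = x ∨ u = y := by
    intro u hu
    have hd : G.distIn A x y ≤ 1 := by
      rcases hxy with rfl | hxy
      · rw [distIn_self hx.1]; omega
      · exact (NearIn.of_adj hxy hx.1 hy.1).distIn_le
    have := hu.2
    rcases (by omega : G.distIn A x u = 0 ∨ G.distIn A u y = 0) with h0 | h0
    · exact Or.inl (hcA.eq_of_distIn_eq_zero hx.1 hu.1 h0).symm
    · exact Or.inr (hcA.eq_of_distIn_eq_zero hu.1 hy.1 h0)
  rcases hv with ⟨hv, hvB⟩ | ⟨b, hb, hbs, -⟩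
  · rcases hseg hv with rfl | rfl
    · exact NearIn.refl hx 1
    · rcases hxy with rfl | hxy
      · exact NearIn.refl hx 1
      · exact NearIn.of_adj hxy.symm hy hx
  · rcases hseg hbs with rfl | rfl
    · exact absurd hb hx.2
    · exact absurd hb hy.2

end IsConeFamily

/-- Removing cone points with hyperbolic bases, each quasi-isometrically embedded in the complement
of its cone point, from a hyperbolic graph leaves a hyperbolic graph. -/
theorem exists_hyperbolic_of_isConeFamily (N : ℕ) :
    ∃ N' : ℕ, ∀ (α : Type*) (G : SimpleGraph α) (A B : Set α) (C : α → Set α),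
      (A \ B).Nonempty → G.IsConeFamily A B C N → IsHyperbolicGraph N' (G.induce (A \ B)) := by
  set E := N * (16 * N + 14) + N with hE
  obtain ⟨N', hN'⟩ := exists_hyperbolic_of_slim_sets ((4 * E + 1) * (N + 1) + 4 * E + N + 1)
  refine ⟨N', fun α G A B C hne h => hN' α G (A \ B) (G.deconedSeg A B C) hne ?_ ?_ ?_⟩
  · exact fun x hx y hy => h.exists_walk _ x hx y hy le_rfl
  · exact fun x hx y hy hxy v _ hv => (h.deconedSeg_small hx hy hxy hv).le (by omega)
  · intro x hx y hy z hz v _ hv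
    rw [deconedSeg_comm z y]
    rcases hv with ⟨hv, hvB⟩ | ⟨b, hb, hbs, a, ha, a', ha', hv⟩
    · obtain ⟨w, hw, hvw⟩ := h.slim_of_mem_seg hE.ge hx hy hz hv hvB
      exact ⟨w, hw, hvw.le (by omega)⟩
    · obtain ⟨w, hw, hvw⟩ := h.slim_of_mem_base_seg hE.ge hx hy hz hb hbs ha ha' hv
      exact ⟨w, hw, hvw.le (by omega)⟩

end SimpleGraph

/-! ### Excising a set that can be bypassed through one vertex. -/

namespace SimpleGraph

variable {α : Type*} {G : SimpleGraph α} {S P : Set α} {o x y : α} {N r : ℕ}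

/-- The set `P` can be bypassed in `S` within distance `r` of the vertex `o ∈ S \ P`. -/
structure IsExcisable (G : SimpleGraph α) (S P : Set α) (o : α) (r : ℕ) : Prop where
  mem : o ∈ S \ P
  near : ∀ p ∈ S, p ∈ P → G.NearIn S r p o
  near_of_adj : ∀ x ∈ S \ P, ∀ p ∈ S, p ∈ P → G.Adj x p → G.NearIn (S \ P) r x o
  one_le : 1 ≤ r

namespace IsExcisable

/-- Each excursion into `P` is replaced by a detour through `o`. An edge entering or leaving `P`
costs `r` and an edge inside `P` costs nothing; a walk starting in `P` is treated as starting at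
`o`. Detours stay within `r` of the vertex from which they depart or to which they return. -/
theorem nearIn_push (h : G.IsExcisable S P o r) {w y : α} (p : G.Walk w y) :
    (∀ v ∈ p.support, v ∈ S) → y ∉ P →
      (w ∉ P → G.NearIn ((S \ P) ∩ {v | ∃ u ∈ p.support, G.NearIn S r v u}) (r * p.length) w y) ∧
      (w ∈ P → G.NearIn ((S \ P) ∩ {v | ∃ u ∈ p.support, G.NearIn S r v u})
          (r * p.length) o y) := by
  induction p with
  | @nil y =>
    intro hS hy
    have hyS : y ∈ S := hS y (by simp)
    have hmem : y ∈ (S \ P) ∩ {v | ∃ u ∈ (Walk.nil : G.Walk y y).support, G.NearIn S r v u} :=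
      ⟨⟨hyS, hy⟩, y, by simp, NearIn.refl hyS r⟩
    exact ⟨fun _ => NearIn.refl hmem _, fun h => absurd h hy⟩
  | @cons w u y hwu q ih =>
    intro hS hy
    have hwS : w ∈ S := hS w (by simp)
    have hqS : ∀ v ∈ q.support, v ∈ S := fun v hv => hS v (by simp [hv])
    have huS : u ∈ S := hqS u q.start_mem_support
    obtain ⟨ih₁, ih₂⟩ := ih hqS hy
    have hsub : ((S \ P) ∩ {v | ∃ u ∈ q.support, G.NearIn S r v u}) ⊆
        ((S \ P) ∩ {v | ∃ t ∈ (q.cons hwu).support, G.NearIn S r v t}) := by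
      rintro v ⟨hv, t, ht, hvt⟩
      exact ⟨hv, t, by simp [ht], hvt⟩
    have hpath : ∀ x ∈ S \ P, x ∈ (q.cons hwu).support → G.NearIn (S \ P) r x o →
        G.NearIn ((S \ P) ∩ {v | ∃ t ∈ (q.cons hwu).support, G.NearIn S r v t}) r x o := by
      rintro x hx hxs ⟨s, hs, hsS⟩
      refine ⟨s, hs, fun v hv => ⟨hsS v hv, x, hxs, ?_⟩⟩
      obtain ⟨a, b, rfl⟩ := Walk.mem_support_iff_exists_append.1 hv
      rw [Walk.length_append] at hs
      refine NearIn.symm ⟨a, by omega, fun w hw => (hsS w ?_).1⟩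
      exact (Walk.mem_support_append_iff _ _).2 (Or.inl hw)
    have hr := h.one_le
    have hlen : r * (q.cons hwu).length = r * q.length + r := by
      rw [Walk.length_cons, Nat.mul_succ]
    rw [hlen]
    refine ⟨fun hw => ?_, fun hw => ?_⟩
    · have hwmem : w ∈ (S \ P) ∩ {v | ∃ t ∈ (q.cons hwu).support, G.NearIn S r v t} :=
        ⟨⟨hwS, hw⟩, w, by simp, NearIn.refl hwS r⟩
      by_cases hu : u ∈ P
      · have h₁ := hpath w ⟨hwS, hw⟩ (by simp) (h.near_of_adj w ⟨hwS, hw⟩ u huS hu hwu)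
        exact (h₁.trans ((ih₂ hu).mono hsub)).le (by omega)
      · have h₁ := (ih₁ hu).mono hsub
        exact ((NearIn.of_adj hwu hwmem h₁.left_mem).trans h₁).le (by omega)
    · by_cases hu : u ∈ P
      · exact ((ih₂ hu).mono hsub).le (by omega)
      · have h₁ := hpath u ⟨huS, hu⟩ (by simp) (h.near_of_adj u ⟨huS, hu⟩ w hwS hw hwu.symm)
        exact (h₁.symm.trans ((ih₁ hu).mono hsub)).le (by omega)

theorem nearIn (h : G.IsExcisable S P o r) {n : ℕ} (hn : G.NearIn S n x y) (hx : x ∉ P)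
    (hy : y ∉ P) : G.NearIn (S \ P) (r * n) x y := by
  obtain ⟨p, hp, hS⟩ := hn
  exact (((h.nearIn_push p hS hy).1 hx).mono Set.inter_subset_left).le (Nat.mul_le_mul_left r hp)

end IsExcisable

theorem exists_hyperbolic_of_isExcisable (N r : ℕ) :
    ∃ N' : ℕ, ∀ (α : Type*) (G : SimpleGraph α) (S P : Set α) (o : α),
      G.SlimIn N S → G.IsExcisable S P o r → IsHyperbolicGraph N' (G.induce (S \ P)) := by
  obtain ⟨N', hN'⟩ := exists_hyperbolic_of_slim_sets (r * (2 * r + N + 1))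
  refine ⟨N', fun α G S P o hS h => hN' α G (S \ P)
    (fun x y => {v | ∃ u ∈ G.seg S x y, G.NearIn S r v u}) ⟨o, h.mem⟩ ?_ ?_ ?_⟩
  · intro x hx y hy
    obtain ⟨p, hp⟩ := hS.conn.exists_geod hx.1 hy.1
    refine ⟨_, ((h.nearIn_push p hp.2 hy.2).1 hx.2).mono ?_⟩
    rintro v ⟨hv, u, hu, hvu⟩
    exact ⟨hv, u, hp.mem_seg hu, hvu⟩
  · rintro x hx y hy hxy v hv ⟨u, hu, hvu⟩
    have hd : G.distIn S x y ≤ 1 := by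
      rcases hxy with rfl | hxy
      · rw [distIn_self hx.1]; omega
      · exact (NearIn.of_adj hxy hx.1 hy.1).distIn_le
    have hux : G.NearIn S 1 u x :=
      (hS.conn.nearIn hx.1 hu.1).symm.le (by have := hu.2; omega)
    exact (h.nearIn (hvu.trans hux) hv.2 hx.2).le (Nat.mul_le_mul_left r (by omega))
  · rintro x hx y hy z hz v hv ⟨u, hu, hvu⟩
    obtain ⟨u', hu', hus, huu'⟩ := hS.slim_seg hx.1 hy.1 hz.1 hu
    have hvu' := hvu.trans ((hS.conn.nearIn hu.1 hu').le huu')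
    have hus' : u' ∈ G.seg S x z ∨ u' ∈ G.seg S z y := by
      rw [seg_comm z y]
      exact hus.symm
    -- A comparison point that has been deleted is replaced by `o`, which is `r`-close to it and so
    -- belongs to the thickened side.
    by_cases hP : u' ∈ P
    · have ho := h.near u' hu' hP
      exact ⟨o, hus'.imp (fun hs => ⟨u', hs, ho.symm⟩) (fun hs => ⟨u', hs, ho.symm⟩),
        (h.nearIn (hvu'.trans ho) hv.2 h.mem.2).le (Nat.mul_le_mul_left r (by omega))⟩
    · have ho := NearIn.refl (G := G) hu' r
      exact ⟨u', hus'.imp (fun hs => ⟨u', hs, ho⟩) (fun hs => ⟨u', hs, ho⟩),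
        (h.nearIn hvu' hv.2 hP).le (Nat.mul_le_mul_left r (by omega))⟩

end SimpleGraph

/-! ### Excising `F^⊥` from the augmented graph of a domain containing `F`. -/

namespace CHHF

open SimpleGraph

variable {V : Type u} {X : SimpleGraph V} {𝔉 : Set (Set V)} {F H K L M : Set V} {n : ℕ} {δ : ℝ}

section Augmented

variable {S : Set V} {W : SimpleGraph (MaxClique X S)} {v w : V}

theorem augAdj_inl_inr : (augAdj X W).Adj (Sum.inl v) (Sum.inr H) ↔ v ∈ H := by
  simp [augAdj, augRel]

theorem augAdj_inr_inl : (augAdj X W).Adj (Sum.inr H) (Sum.inl v) ↔ v ∈ H := by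
  simp [augAdj, augRel]

theorem not_augAdj_inr_inr : ¬ (augAdj X W).Adj (Sum.inr H) (Sum.inr K) := by
  simp [augAdj, augRel]

theorem augAdj_inl_inl : (augAdj X W).Adj (Sum.inl v) (Sum.inl w) ↔
    v ≠ w ∧ (X.Adj v w ∨ ∃ c d : MaxClique X S, W.Adj c d ∧ v ∈ c.1 ∧ w ∈ d.1) := by
  simp only [augAdj, fromRel_adj, augRel, ne_eq, Sum.inl.injEq]
  refine and_congr_right fun _ => ⟨?_, Or.inl⟩
  rintro (h | h | ⟨c, d, hcd, hw, hv⟩)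
  exacts [h, Or.inl h.symm, Or.inr ⟨d, c, hcd.symm, hv, hw⟩]

end Augmented

theorem link_anti (h : F ⊆ L) : link X L ⊆ link X F := fun _ hv w hw => hv w (h hw)

theorem not_mem_link {v : V} (hv : v ∈ F) : v ∉ link X F := fun h => (h v hv).ne rfl

theorem not_subset_link (hF : F.Nonempty) (hFL : F ⊆ L) : ¬ L ⊆ link X F := fun h =>
  let ⟨_, hf⟩ := hF
  not_mem_link hf (h (hFL hf))

/-- Domains of a graph factor system have bounded coheight. -/
theorem IsGraphFactorSystem.exists_coheight (h : IsGraphFactorSystem X 𝔉 n) :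
    ∃ ht : Set V → ℕ, (∀ L ∈ 𝔉, ht L ≤ n) ∧ ∀ L ∈ 𝔉, ∀ H ∈ 𝔉, L ⊂ H → ht H < ht L := by
  classical
  have hle : ∀ L : 𝔉, Order.coheight L ≤ n := fun L =>
    Order.coheight_le fun p _ => by
      have := h.chain_lt (p.length + 1) (fun i => (p i).1) (fun i j hij => p.strictMono hij)
        fun i => (p i).2
      exact_mod_cast (by omega : p.length ≤ n)
  have hfin : ∀ L : 𝔉, Order.coheight L < ⊤ := fun L => (hle L).trans_lt (ENat.natCast_lt_top n)
  refine ⟨fun L => if hL : L ∈ 𝔉 then (Order.coheight (⟨L, hL⟩ : 𝔉)).toNat else 0, ?_, ?_⟩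
  · intro L hL
    simp only [hL, dif_pos]
    exact ENat.toNat_le_of_le_natCast (hle _)
  · intro L hL H hH hLH
    simp only [hL, hH, dif_pos]
    have hlt : (⟨L, hL⟩ : 𝔉) < ⟨H, hH⟩ := hLH
    have := Order.coheight_strictAnti hlt (hfin _)
    rw [← ENat.natCast_lt_natCast, ENat.natCast_toNat (hfin _).ne, ENat.natCast_toNat (hfin _).ne]
    exact this

theorem IsGraphFactorSystem.exists_minimal (h : IsGraphFactorSystem X 𝔉 n) (p : Set V → Prop)
    (hK : K ∈ 𝔉) (hp : p K) : ∃ M ∈ 𝔉, p M ∧ M ⊆ K ∧ ∀ M' ∈ 𝔉, M' ⊂ M → ¬ p M' := by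
  obtain ⟨ht, hle, hlt⟩ := h.exists_coheight
  obtain ⟨M, ⟨hM, hpM, hMK⟩, hmin⟩ := (measure fun M => n - ht M).wf.has_min
    {M | M ∈ 𝔉 ∧ p M ∧ M ⊆ K} ⟨K, hK, hp, subset_rfl⟩
  refine ⟨M, hM, hpM, hMK, fun M' hM' hM'M hpM' => ?_⟩
  have h₁ := hmin M' ⟨hM', hpM', hM'M.1.trans hMK⟩
  have h₂ := hlt M' hM' M hM hM'M
  have h₃ := hle M' hM'
  exact h₁ (show n - ht M' < n - ht M by omega)

/-- The vertices of `F^⊥` and the projection vertices of domains contained in `F^⊥`. -/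
def perpPart (X : SimpleGraph V) (F : Set V) : Set (AugVertex V) :=
  Sum.inl '' link X F ∪ Sum.inr '' {K | K ⊆ link X F}

theorem inl_mem_perpPart {v : V} : Sum.inl v ∈ perpPart X F ↔ v ∈ link X F := by
  simp [perpPart]

theorem inr_mem_perpPart : Sum.inr K ∈ perpPart X F ↔ K ⊆ link X F := by
  simp [perpPart]

theorem inl_mem_augVerts {v : V} : Sum.inl v ∈ augVerts 𝔉 L ↔ v ∈ L := by
  simp [augVerts]

theorem inr_mem_augVerts : Sum.inr K ∈ augVerts 𝔉 L ↔ K ∈ 𝔉 ∧ K ⊂ L := by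
  simp [augVerts]

theorem inl_mem_complVerts {v : V} : Sum.inl v ∈ complVerts X 𝔉 F ↔ v ∉ link X F := by
  simp [complVerts, augVerts, projPart]

theorem inr_mem_complVerts : Sum.inr K ∈ complVerts X 𝔉 F ↔
    (K ∈ 𝔉 ∧ K ⊂ Set.univ) ∧ ¬ (K ⊆ link X F ∨ F ⊆ K) := by
  change (_ ∈ _ ∧ ¬ _) ↔ _
  rw [inr_mem_augVerts]
  refine and_congr_right fun h => not_congr ?_
  simp only [projPart, Set.mem_union, Set.mem_image, reduceCtorEq, and_false, exists_false,
    false_or, Sum.inr.injEq, exists_eq_right]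
  exact ⟨fun hK => hK.2.2, fun hK => ⟨h.1, h.2, hK⟩⟩

section

variable {W : SimpleGraph (MaxClique X Set.univ)}

/-- The edges between vertices of a domain `L` in the augmented graph come from an `L`-graph. -/
theorem HierarchyCondition.exists_local (h : HierarchyCondition X W 𝔉) (hL : L ∈ 𝔉) :
    ∃ WL : SimpleGraph (MaxClique X L), ∀ v ∈ L, ∀ w ∈ L,
      ((augAdj X W).Adj (Sum.inl v) (Sum.inl w) ↔ (augAdj X WL).Adj (Sum.inl v) (Sum.inl w)) := by
  obtain ⟨WF, hWF⟩ := h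
  refine ⟨WF L, fun v hv w hw => ?_⟩
  have heq := (hWF L hL L hL subset_rfl).1
  have := congrArg (fun G : SimpleGraph (augVerts 𝔉 L) =>
    G.Adj ⟨Sum.inl v, inl_mem_augVerts.2 hv⟩ ⟨Sum.inl w, inl_mem_augVerts.2 hw⟩) heq
  exact (iff_of_eq this).symm

namespace IsCHHF

/-- The intersection `lk(u) ∩ L` is a domain containing `F` and `v`, and it is proper in `L` since
it omits `u`. Its projection vertex joins `v` to any `f ∈ F`, which is adjacent to `b_F`. -/
theorem nearIn_of_adj_link (h : IsCHHF X W 𝔉 n δ) {u v : V} (hF : F ∈ 𝔉) (hL : L ∈ 𝔉)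
    (hFL : F ⊂ L) (hu : u ∈ link X F)
    (huL : u ∈ L) (hv : v ∉ link X F) (hvL : v ∈ L) (huv : X.Adj v u) :
    (augAdj X W).NearIn (augVerts 𝔉 L \ perpPart X F) 3 (Sum.inl v) (Sum.inr F) := by
  obtain ⟨f, hf⟩ := h.factorSystem.nonempty F hF
  have hFM : F ⊆ link X {u} ∩ L := fun w hw =>
    ⟨fun t ht => by rw [Set.mem_singleton_iff.1 ht]; exact (hu w hw).symm, hFL.1 hw⟩
  have hM : link X {u} ∩ L ∈ 𝔉 := h.factorSystem.inter_mem _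
    (h.factorSystem.link_mem u ⟨f, (hFM hf).1⟩) _ hL ⟨f, hFM hf⟩
  have hML : link X {u} ∩ L ⊂ L := ⟨Set.inter_subset_right, fun hs =>
    not_mem_link (Set.mem_singleton u) (hs huL).1⟩
  have hv' : (Sum.inl v : AugVertex V) ∈ augVerts 𝔉 L \ perpPart X F :=
    ⟨inl_mem_augVerts.2 hvL, fun hp => hv (inl_mem_perpPart.1 hp)⟩
  have hf' : (Sum.inl f : AugVertex V) ∈ augVerts 𝔉 L \ perpPart X F :=
    ⟨inl_mem_augVerts.2 (hFL.1 hf), fun hp => not_mem_link hf (inl_mem_perpPart.1 hp)⟩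
  have hM' : (Sum.inr (link X {u} ∩ L) : AugVertex V) ∈ augVerts 𝔉 L \ perpPart X F :=
    ⟨inr_mem_augVerts.2 ⟨hM, hML⟩, fun hp => not_subset_link ⟨f, hf⟩ hFM (inr_mem_perpPart.1 hp)⟩
  have hF' : (Sum.inr F : AugVertex V) ∈ augVerts 𝔉 L \ perpPart X F :=
    ⟨inr_mem_augVerts.2 ⟨hF, hFL⟩, fun hp =>
      not_subset_link ⟨f, hf⟩ subset_rfl (inr_mem_perpPart.1 hp)⟩
  have hvM : v ∈ link X {u} ∩ L :=
    ⟨fun t ht => by rw [Set.mem_singleton_iff.1 ht]; exact huv, hvL⟩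
  exact ((NearIn.of_adj (augAdj_inl_inr.2 hvM) hv' hM').trans
    (NearIn.of_adj (augAdj_inr_inl.2 (hFM hf)) hM' hf')).trans
    (NearIn.of_adj (augAdj_inl_inr.2 hf) hf' hF')

theorem nearIn_of_augAdj_inl (h : IsCHHF X W 𝔉 n δ) {u v : V} (hF : F ∈ 𝔉) (hL : L ∈ 𝔉)
    (hFL : F ⊂ L)
    (hu : u ∈ link X F) (huL : u ∈ L) (hv : v ∉ link X F) (hvL : v ∈ L)
    (huv : (augAdj X W).Adj (Sum.inl v) (Sum.inl u)) :
    (augAdj X W).NearIn (augVerts 𝔉 L \ perpPart X F) 4 (Sum.inl v) (Sum.inr F) := by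
  obtain ⟨WL, hWL⟩ := h.hierarchy.exists_local hL
  obtain ⟨f, hf⟩ := h.factorSystem.nonempty F hF
  rcases (augAdj_inl_inl.1 ((hWL v hvL u huL).1 huv)).2 with hX | ⟨c, d, hcd, hvc, hud⟩
  · exact (h.nearIn_of_adj_link hF hL hFL hu huL hv hvL hX).le (by omega)
  -- If `d` were contained in `F^⊥`, adding `f ∈ F` would enlarge it inside `L`. The hierarchy
  -- condition is what makes `d` a maximal clique of `L` rather than of `X`, so that `y` stays in
  -- `L`.
  have hd : ∃ y ∈ d.1, y ∉ link X F := by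
    by_contra! hd
    have hins : insert f d.1 ⊆ L ∧ X.IsClique (insert f d.1) :=
      ⟨Set.insert_subset (hFL.1 hf) d.2.prop.1,
        d.2.prop.2.insert fun y hy _ => (hd y hy f hf).symm⟩
    exact not_mem_link hf (hd f (d.2.le_of_ge hins (Set.subset_insert f d.1)
      (Set.mem_insert f d.1)))
  obtain ⟨y, hyd, hy⟩ := hd
  have hyL : y ∈ L := d.2.prop.1 hyd
  have hyu : X.Adj y u := d.2.prop.2 hyd hud (by rintro rfl; exact hy hu)
  have hnear := h.nearIn_of_adj_link hF hL hFL hu huL hy hyL hyu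
  by_cases hvy : v = y
  · subst hvy
    exact hnear.le (by omega)
  · have hadj := (hWL v hvL y hyL).2 (augAdj_inl_inl.2 ⟨hvy, Or.inr ⟨c, d, hcd, hvc, hyd⟩⟩)
    have hv' : (Sum.inl v : AugVertex V) ∈ augVerts 𝔉 L \ perpPart X F :=
      ⟨inl_mem_augVerts.2 hvL, fun hp => hv (inl_mem_perpPart.1 hp)⟩
    exact ((NearIn.of_adj hadj hv' hnear.left_mem).trans hnear).le (by omega)

/-- Take a minimal domain `M ⊆ K` that meets `F^⊥` without being contained in it. A path in the
connected graph `CM` must cross into `perpPart`, and minimality forbids crossing from a projection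
vertex to a vertex of `F^⊥`. -/
theorem exists_augAdj_of_not_subset_link (h : IsCHHF X W 𝔉 n δ) (hK : K ∈ 𝔉)
    (hKF : ¬ K ⊆ link X F) {u : V} (huK : u ∈ K)
    (hu : u ∈ link X F) :
    ∃ v ∈ K, ∃ t ∈ K, v ∉ link X F ∧ t ∈ link X F ∧
      (augAdj X W).Adj (Sum.inl v) (Sum.inl t) := by
  obtain ⟨M, hM, ⟨hMF, t, htM, ht⟩, hMK, hmin⟩ := h.factorSystem.exists_minimal
    (fun M => ¬ M ⊆ link X F ∧ ∃ t ∈ M, t ∈ link X F) hK ⟨hKF, u, huK, hu⟩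
  obtain ⟨w, hwM, hw⟩ := Set.not_subset.1 hMF
  obtain ⟨m, p, -, hp⟩ := connIn_of_connected (h.hyperbolicity M hM).1.1 (Sum.inl w)
    (inl_mem_augVerts.2 hwM) (Sum.inl t) (inl_mem_augVerts.2 htM)
  obtain ⟨d, hd, hd₁, hd₂⟩ := p.exists_boundary_dart {a | a ∉ perpPart X F}
    (fun h => hw (inl_mem_perpPart.1 h)) (fun h => h (inl_mem_perpPart.2 ht))
  have hS₁ := hp _ (p.dart_fst_mem_support_of_mem_darts hd)
  have hS₂ := hp _ (p.dart_snd_mem_support_of_mem_darts hd)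
  obtain ⟨⟨a, b⟩, hab⟩ := d
  change a ∉ perpPart X F at hd₁
  replace hd₂ : b ∈ perpPart X F := not_not.1 hd₂
  change a ∈ augVerts 𝔉 M at hS₁
  change b ∈ augVerts 𝔉 M at hS₂
  change (augAdj X W).Adj a b at hab
  rcases a with a | a <;> rcases b with b | b
  · exact ⟨a, hMK (inl_mem_augVerts.1 hS₁), b, hMK (inl_mem_augVerts.1 hS₂),
      fun h => hd₁ (inl_mem_perpPart.2 h), inl_mem_perpPart.1 hd₂, hab⟩
  · exact absurd (inl_mem_perpPart.2 (inr_mem_perpPart.1 hd₂ (augAdj_inl_inr.1 hab))) hd₁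
  · obtain ⟨ha, haM⟩ := inr_mem_augVerts.1 hS₁
    exact absurd ⟨fun h => hd₁ (inr_mem_perpPart.2 h), b, augAdj_inr_inl.1 hab,
      inl_mem_perpPart.1 hd₂⟩ (hmin a ha haM)
  · exact absurd hab not_augAdj_inr_inr

theorem isExcisable_perpPart (h : IsCHHF X W 𝔉 n δ) (hF : F ∈ 𝔉) (hL : L ∈ 𝔉) (hFL : F ⊂ L) :
    (augAdj X W).IsExcisable (augVerts 𝔉 L) (perpPart X F) (Sum.inr F) 5 := by
  obtain ⟨f, hf⟩ := h.factorSystem.nonempty F hF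
  have hFS : (Sum.inr F : AugVertex V) ∈ augVerts 𝔉 L := inr_mem_augVerts.2 ⟨hF, hFL⟩
  have hfS : (Sum.inl f : AugVertex V) ∈ augVerts 𝔉 L := inl_mem_augVerts.2 (hFL.1 hf)
  have hnear : ∀ u ∈ L, u ∈ link X F →
      (augAdj X W).NearIn (augVerts 𝔉 L) 2 (Sum.inl u) (Sum.inr F) := fun u huL hu =>
    (NearIn.of_adj (augAdj_inl_inl.2 ⟨(hu f hf).ne, Or.inl (hu f hf)⟩) (inl_mem_augVerts.2 huL)
      hfS).trans (NearIn.of_adj (augAdj_inl_inr.2 hf) hfS hFS)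
  refine ⟨⟨hFS, fun hp => not_subset_link ⟨f, hf⟩ subset_rfl (inr_mem_perpPart.1 hp)⟩, ?_, ?_,
    by omega⟩
  · rintro (u | K) hS hP
    · exact (hnear u (inl_mem_augVerts.1 hS) (inl_mem_perpPart.1 hP)).le (by omega)
    · obtain ⟨hK, hKL⟩ := inr_mem_augVerts.1 hS
      obtain ⟨k, hk⟩ := h.factorSystem.nonempty K hK
      exact ((NearIn.of_adj (augAdj_inr_inl.2 hk) hS (inl_mem_augVerts.2 (hKL.1 hk))).trans
        (hnear k (hKL.1 hk) (inr_mem_perpPart.1 hP hk))).le (by omega)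
  · rintro (v | K) ⟨hxS, hxP⟩ (u | M) hS hP hadj
    · exact (h.nearIn_of_augAdj_inl hF hL hFL (inl_mem_perpPart.1 hP) (inl_mem_augVerts.1 hS)
        (fun h => hxP (inl_mem_perpPart.2 h)) (inl_mem_augVerts.1 hxS) hadj).le (by omega)
    · exact absurd (inl_mem_perpPart.2 (inr_mem_perpPart.1 hP (augAdj_inl_inr.1 hadj))) hxP
    -- Starting from `b_K`, step to the outer end of a crossing edge inside `K` and then use the
    -- bound 4 for that edge; hence the constant 5.
    · obtain ⟨hK, hKL⟩ := inr_mem_augVerts.1 hxS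
      obtain ⟨v, hvK, t, htK, hv, ht, hvt⟩ := h.exists_augAdj_of_not_subset_link hK
        (fun h => hxP (inr_mem_perpPart.2 h)) (augAdj_inr_inl.1 hadj) (inl_mem_perpPart.1 hP)
      have hn := h.nearIn_of_augAdj_inl hF hL hFL ht (hKL.1 htK) hv (hKL.1 hvK) hvt
      have hx : (Sum.inr K : AugVertex V) ∈ augVerts 𝔉 L \ perpPart X F := ⟨hxS, hxP⟩
      exact ((NearIn.of_adj (augAdj_inr_inl.2 hvK) hx hn.left_mem).trans hn).le (by omega)
    · exact absurd hadj not_augAdj_inr_inr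

/-- The lower quasi-isometry inequality bounds the distance in `CL` by `δ * m + δ * δ`. -/
theorem nearIn_augVerts (h : IsCHHF X W 𝔉 n δ) (hL : L ∈ 𝔉) (hδ : 0 < δ) {D m : ℕ} (hD : δ ≤ D)
    (hD' : δ * δ ≤ D)
    {x y : AugVertex V} (hx : x ∈ augVerts 𝔉 L) (hy : y ∈ augVerts 𝔉 L)
    (hxy : (augAdj X W).NearIn (complVerts X 𝔉 L) m x y) :
    (augAdj X W).NearIn (augVerts 𝔉 L) (D * m + D) x y := by
  obtain ⟨hyp, hsub, hqi⟩ := h.hyperbolicity L hL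
  obtain ⟨-, hlow, -⟩ := hqi ⟨x, hx⟩ ⟨y, hy⟩
  have h₁ : (complGraph X W 𝔉 L).dist (Set.inclusion hsub ⟨x, hx⟩) (Set.inclusion hsub ⟨y, hy⟩) ≤
      m := by
    exact (distIn_eq_dist (hsub hx) (hsub hy)).symm.trans_le hxy.distIn_le
  have h₂ : (augAdj X W).distIn (augVerts 𝔉 L) x y = (augGraph X W 𝔉 L).dist ⟨x, hx⟩ ⟨y, hy⟩ :=
    distIn_eq_dist hx hy
  refine ((connIn_of_connected hyp.1).nearIn hx hy).le ?_
  rw [h₂]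
  set a := (augGraph X W 𝔉 L).dist ⟨x, hx⟩ ⟨y, hy⟩
  have h₃ : (a : ℝ) / δ ≤ m + δ := by
    have : ((complGraph X W 𝔉 L).dist (Set.inclusion hsub ⟨x, hx⟩)
      (Set.inclusion hsub ⟨y, hy⟩) : ℝ) ≤ m := by exact_mod_cast h₁
    linarith
  rw [div_le_iff₀ hδ] at h₃
  have h₄ : (m : ℝ) * δ ≤ m * D := mul_le_mul_of_nonneg_left hD (Nat.cast_nonneg m)
  have h₅ : (a : ℝ) ≤ ((D * m + D : ℕ) : ℝ) := by
    push_cast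
    nlinarith
  exact_mod_cast h₅

end IsCHHF

theorem exists_hyperbolic_augVerts_diff (N : ℕ) :
    ∃ N' : ℕ, ∀ (V : Type u) (X : SimpleGraph V) (W : SimpleGraph (MaxClique X Set.univ))
      (𝔉 : Set (Set V)) (n : ℕ) (δ : ℝ), IsCHHF X W 𝔉 n δ → δ ≤ N → ∀ F ∈ 𝔉, ∀ L ∈ 𝔉, F ⊆ L →
        IsHyperbolicGraph N' ((augAdj X W).induce (augVerts 𝔉 L \ perpPart X F)) ∧
        ∀ x ∈ augVerts 𝔉 L \ perpPart X F, ∀ y ∈ augVerts 𝔉 L \ perpPart X F, ∀ m,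
          (augAdj X W).NearIn (augVerts 𝔉 L) m x y →
          (augAdj X W).NearIn (augVerts 𝔉 L \ perpPart X F) (5 * m) x y := by
  obtain ⟨N', hN'⟩ := exists_hyperbolic_of_isExcisable N 5
  refine ⟨max N N', fun V X W 𝔉 n δ h hδ F hF L hL hFL => ?_⟩
  have hyp : IsHyperbolicGraph N ((augAdj X W).induce (augVerts 𝔉 L)) :=
    isHyperbolicGraph_mono (h.hyperbolicity L hL).1 hδ
  rcases hFL.eq_or_ssubset with rfl | hFL
  -- For `L = F` there is nothing to excise, and `b_F` is not a vertex of `CF`.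
  · have hdiff : augVerts 𝔉 F \ perpPart X F = augVerts 𝔉 F := by
      refine Set.Subset.antisymm Set.sdiff_subset fun x hx => ⟨hx, fun hP => ?_⟩
      rcases x with v | K
      · exact not_mem_link (inl_mem_augVerts.1 hx) (inl_mem_perpPart.1 hP)
      · obtain ⟨hK, hKF⟩ := inr_mem_augVerts.1 hx
        obtain ⟨k, hk⟩ := h.factorSystem.nonempty K hK
        exact not_mem_link (hKF.1 hk) (inr_mem_perpPart.1 hP hk)
    rw [hdiff]
    exact ⟨isHyperbolicGraph_mono hyp (by exact_mod_cast le_max_left N N'),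
      fun x _ y _ m hm => hm.le (by omega)⟩
  · have hex := h.isExcisable_perpPart hF hL hFL
    exact ⟨isHyperbolicGraph_mono (hN' _ _ _ _ _ (slimIn_of_isHyperbolicGraph hyp) hex)
      (by exact_mod_cast le_max_right N N'), fun x hx y hy m hm => hex.nearIn hm hx.2 hy.2⟩

/-! ### Removing the projection vertices of domains containing `F`, by coheight. -/

/-- The vertices of the complement graph of `F`, together with the projection vertices of the
domains containing `F` whose coheight is at least `i`. -/
def stageVerts (X : SimpleGraph V) (𝔉 : Set (Set V)) (F : Set V) (ht : Set V → ℕ) (i : ℕ) :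
    Set (AugVertex V) :=
  complVerts X 𝔉 F ∪ Sum.inr '' {L | L ∈ 𝔉 ∧ F ⊆ L ∧ L ⊂ Set.univ ∧ i ≤ ht L}

/-- The projection vertices of the domains containing `F` of coheight `i`. -/
def levelVerts (𝔉 : Set (Set V)) (F : Set V) (ht : Set V → ℕ) (i : ℕ) : Set (AugVertex V) :=
  Sum.inr '' {L | L ∈ 𝔉 ∧ F ⊆ L ∧ L ⊂ Set.univ ∧ ht L = i}

variable {ht : Set V → ℕ} {i : ℕ}

theorem inl_mem_stageVerts {v : V} : Sum.inl v ∈ stageVerts X 𝔉 F ht i ↔ v ∉ link X F := by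
  rw [← inl_mem_complVerts (𝔉 := 𝔉)]
  simp [stageVerts]

theorem inr_mem_stageVerts : Sum.inr K ∈ stageVerts X 𝔉 F ht i ↔
    (K ∈ 𝔉 ∧ K ⊂ Set.univ) ∧ (¬ (K ⊆ link X F ∨ F ⊆ K) ∨ F ⊆ K ∧ i ≤ ht K) := by
  simp only [stageVerts, Set.mem_union, inr_mem_complVerts, Set.mem_image, Sum.inr.injEq,
    exists_eq_right]
  change _ ∨ (_ ∧ _ ∧ _ ∧ _) ↔ _
  tauto

theorem inl_notMem_levelVerts {v : V} : Sum.inl v ∉ levelVerts 𝔉 F ht i := by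
  simp [levelVerts]

theorem inr_mem_levelVerts : Sum.inr K ∈ levelVerts 𝔉 F ht i ↔
    K ∈ 𝔉 ∧ F ⊆ K ∧ K ⊂ Set.univ ∧ ht K = i := by
  simp only [levelVerts, Set.mem_image, Sum.inr.injEq, exists_eq_right]
  rfl

theorem stageVerts_zero (hF : F.Nonempty) :
    stageVerts X 𝔉 F ht 0 = augVerts 𝔉 Set.univ \ perpPart X F := by
  ext (v | K)
  · rw [inl_mem_stageVerts]
    change _ ↔ _ ∧ ¬ _
    rw [inl_mem_perpPart, inl_mem_augVerts]
    simp
  · rw [inr_mem_stageVerts]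
    change _ ↔ _ ∧ ¬ _
    rw [inr_mem_perpPart, inr_mem_augVerts]
    have := fun h : F ⊆ K => not_subset_link (X := X) hF h
    simp only [Nat.zero_le, and_true]
    tauto

theorem stageVerts_succ :
    stageVerts X 𝔉 F ht (i + 1) = stageVerts X 𝔉 F ht i \ levelVerts 𝔉 F ht i := by
  ext (v | K)
  · change _ ↔ _ ∧ ¬ _
    rw [inl_mem_stageVerts, inl_mem_stageVerts]
    simp [inl_notMem_levelVerts]
  · change _ ↔ _ ∧ ¬ _
    rw [inr_mem_stageVerts, inr_mem_stageVerts, inr_mem_levelVerts,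
      show i + 1 ≤ ht K ↔ i ≤ ht K ∧ ¬ ht K = i by omega]
    tauto

theorem stageVerts_eq_complVerts (hle : ∀ L ∈ 𝔉, ht L < i) :
    stageVerts X 𝔉 F ht i = complVerts X 𝔉 F := by
  refine Set.union_eq_left.2 ?_
  rintro _ ⟨L, ⟨hL, -, -, hi⟩, rfl⟩
  exact absurd (hle L hL) (by omega)

/-- The bases of the cones at the projection vertices of domains containing `F`. -/
def coneBase (X : SimpleGraph V) (𝔉 : Set (Set V)) (F : Set V) : AugVertex V → Set (AugVertex V)
  | Sum.inl _ => ∅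
  | Sum.inr L => augVerts 𝔉 L \ perpPart X F

/-- Domains properly contained in `L` have larger coheight, so their projection vertices have not
been removed yet. -/
theorem coneBase_subset (hL : L ∈ 𝔉)
    (hlt : ∀ L ∈ 𝔉, ∀ H ∈ 𝔉, L ⊂ H → ht H < ht L) (hi : ht L = i) :
    augVerts 𝔉 L \ perpPart X F ⊆ stageVerts X 𝔉 F ht i \ levelVerts 𝔉 F ht i := by
  rw [← stageVerts_succ]
  rintro (v | K) ⟨hS, hP⟩
  · exact inl_mem_stageVerts.2 fun h => hP (inl_mem_perpPart.2 h)
  · obtain ⟨hK, hKL⟩ := inr_mem_augVerts.1 hS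
    have := hlt K hK L hL hKL
    have hKF : ¬ K ⊆ link X F := fun h => hP (inr_mem_perpPart.2 h)
    refine inr_mem_stageVerts.2 ⟨⟨hK, hKL.trans_subset (Set.subset_univ L)⟩, ?_⟩
    by_cases hFK : F ⊆ K
    · exact Or.inr ⟨hFK, by omega⟩
    · exact Or.inl (by tauto)

/-- Domains properly containing `L` have smaller coheight, so their projection vertices are already
gone; and `L^⊥ ⊆ F^⊥` takes care of the rest of the projection part of `L`. -/
theorem stageVerts_diff_subset (hF : F.Nonempty) (hL : L ∈ 𝔉) (hFL : F ⊆ L)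
    (hlt : ∀ L ∈ 𝔉, ∀ H ∈ 𝔉, L ⊂ H → ht H < ht L) (hi : ht L = i) :
    stageVerts X 𝔉 F ht i \ {Sum.inr L} ⊆ complVerts X 𝔉 L := by
  rintro (v | K) ⟨hS, hne⟩
  · exact inl_mem_complVerts.2 fun h => inl_mem_stageVerts.1 hS (link_anti hFL h)
  · obtain ⟨hK, hK'⟩ := inr_mem_stageVerts.1 hS
    refine inr_mem_complVerts.2 ⟨hK, ?_⟩
    rintro (hKL | hLK)
    · have hKF := hKL.trans (link_anti hFL)
      rcases hK' with hK' | ⟨hFK, -⟩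
      · exact hK' (Or.inl hKF)
      · exact not_subset_link hF hFK hKF
    · rcases hK' with hK' | ⟨-, hiK⟩
      · exact hK' (Or.inr (hFL.trans hLK))
      · have hne' : L ≠ K := by rintro rfl; exact hne rfl
        have := hlt L hL K hK.1 (hLK.ssubset_of_ne hne')
        omega

theorem exists_hyperbolic_stageVerts (δ : ℝ) (hδ : 0 < δ) (i : ℕ) :
    ∃ N : ℕ, ∀ (V : Type u) (X : SimpleGraph V) (W : SimpleGraph (MaxClique X Set.univ))
      (𝔉 : Set (Set V)) (n : ℕ), IsCHHF X W 𝔉 n δ → ∀ F ∈ 𝔉, ∀ ht : Set V → ℕ,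
        (∀ L ∈ 𝔉, ∀ H ∈ 𝔉, L ⊂ H → ht H < ht L) →
        IsHyperbolicGraph N ((augAdj X W).induce (stageVerts X 𝔉 F ht i)) := by
  obtain ⟨D, hD, hD'⟩ : ∃ D : ℕ, δ ≤ D ∧ δ * δ ≤ D := by
    obtain ⟨D, hD⟩ := exists_nat_ge (max δ (δ * δ))
    exact ⟨D, (le_max_left _ _).trans hD, (le_max_right _ _).trans hD⟩
  obtain ⟨M, hM⟩ := exists_hyperbolic_augVerts_diff.{u} D
  induction i with
  | zero =>
    refine ⟨M, fun V X W 𝔉 n h F hF ht hlt => ?_⟩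
    rw [stageVerts_zero (h.factorSystem.nonempty F hF)]
    exact (hM V X W 𝔉 n δ h hD F hF _ h.factorSystem.univ_mem (Set.subset_univ F)).1
  | succ i ih =>
    obtain ⟨N, hN⟩ := ih
    -- `N` serves the current stage and `M` the bases. `5 * D` comes from passing from `Y_L` to `CL`
    -- (`D * m + D`) and then excising `perpPart` (factor 5).
    obtain ⟨N', hN'⟩ := exists_hyperbolic_of_isConeFamily (N + M + 5 * D)
    refine ⟨N', fun V X W 𝔉 n h F hF ht hlt => ?_⟩
    have hFne := h.factorSystem.nonempty F hF
    rw [stageVerts_succ]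
    refine hN' _ _ _ _ (coneBase X 𝔉 F) ?_ ⟨?_, ?_, ?_, ?_, ?_, ?_⟩
    · obtain ⟨f, hf⟩ := hFne
      exact ⟨Sum.inl f, inl_mem_stageVerts.2 (not_mem_link hf), inl_notMem_levelVerts⟩
    · refine slimIn_of_isHyperbolicGraph (isHyperbolicGraph_mono (hN V X W 𝔉 n h F hF ht hlt) ?_)
      exact_mod_cast (by omega : N ≤ N + M + 5 * D)
    · rintro _ ⟨L, ⟨hL, hFL, hLX, hi⟩, rfl⟩
      exact inr_mem_stageVerts.2 ⟨⟨hL, hLX⟩, Or.inr ⟨hFL, hi.ge⟩⟩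
    · rintro _ ⟨L, ⟨hL, hFL, hLX, hi⟩, rfl⟩
      exact coneBase_subset hL hlt hi
    · rintro _ ⟨L, ⟨hL, hFL, hLX, hi⟩, rfl⟩ (v | K) hS hadj
      · exact ⟨inl_mem_augVerts.2 (augAdj_inl_inr.1 hadj), fun hP =>
          inl_mem_stageVerts.1 hS (inl_mem_perpPart.1 hP)⟩
      · exact absurd hadj not_augAdj_inr_inr
    · rintro _ ⟨L, ⟨hL, hFL, hLX, hi⟩, rfl⟩
      refine slimIn_of_isHyperbolicGraph
        (isHyperbolicGraph_mono (hM V X W 𝔉 n δ h hD F hF L hL hFL).1 ?_)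
      exact_mod_cast (by omega : M ≤ N + M + 5 * D)
    · rintro _ ⟨L, ⟨hL, hFL, hLX, hi⟩, rfl⟩ x hx y hy m hxy
      have h₁ := h.nearIn_augVerts hL hδ hD hD' hx.1 hy.1
        (hxy.mono (stageVerts_diff_subset hFne hL hFL hlt hi))
      refine ((hM V X W 𝔉 n δ h hD F hF L hL hFL).2 x hx y hy _ h₁).le ?_
      nlinarith [Nat.zero_le ((N + M) * m)]

end

end CHHF

theorem lemma3p10 (n : ℕ) (δ : ℝ) (hδ : 0 < δ) :
    ∃ δ' : ℝ, 0 < δ' ∧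
      ∀ (V : Type u) (X : SimpleGraph V) (W : SimpleGraph (CHHF.MaxClique X Set.univ))
        (𝔉 : Set (Set V)), CHHF.IsCHHF X W 𝔉 n δ →
          ∀ F ∈ 𝔉, IsHyperbolicGraph δ' (CHHF.complGraph X W 𝔉 F) := by
  -- Coheights are at most `n`, so at stage `n + 1` all the projection vertices in question have
  -- been removed.
  obtain ⟨N, hN⟩ := CHHF.exists_hyperbolic_stageVerts.{u} δ hδ (n + 1)
  refine ⟨N + 1, by positivity, fun V X W 𝔉 h F hF => ?_⟩
  obtain ⟨ht, hle, hlt⟩ := h.factorSystem.exists_coheight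
  have hyp := hN V X W 𝔉 n h F hF ht hlt
  rw [CHHF.stageVerts_eq_complVerts fun L hL => Nat.lt_succ_of_le (hle L hL)] at hyp
  exact SimpleGraph.isHyperbolicGraph_mono hyp (by linarith)
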